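/- All manifolds, forms, metrics, connections and vector fields are holomorphic. Let $M$ be a complex manifold with a holomorphic symplectic form $\omega$, let $\pi\colon X=T_M\to M$ be the total space of its holomorphic tangent bundle, and let $v\colon \pi^*(T_M)\to T_X$ be the canonical map identifying $T_{M,\pi(x)}$ with the tangent space at $x$ to the fibre $T_{M,\pi(x)}$ of $\pi$. Let $h$ be a non-linear connection on $\pi$, that is, a bundle map $h\colon \pi^*(T_M)\to T_X$ with $\pi_*\circ h=1$. For $\epsilon\in\mathbb C^*$ put $h_\epsilon=h+\epsilon^{-1}v$, which is again a non-linear connection. A non-linear connection $h$ is called flat if $H=\operatorname{im}(h)\subset T_X$ satisfies $[H,H]\subset H$. It is called symplectic if it preserves the relative symplectic form $\Omega_\pi$ on $\pi$ defined by $\Omega_\pi(v(u_1),v(u_2))=\omega(u_1,u_2)$, that is, if $\mathcal L_u(\Omega_\pi)=0$ for every (local) horizontal vector field $u$ on $X$; explicitly, if $\Omega$ is the 2-form on $X$ with $\ker\Omega=H$ that extends $\Omega_\pi$, then $u(\Omega(w_1,w_2))=\Omega([u,w_1],w_2)+\Omega(w_1,[u,w_2])$ for all local horizontal vector fields $u$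 and vertical vector fields $w_1,w_2$. The pair $(\omega,h)$ is called a pre-Joyce structure on $M$ if $h_\epsilon$ is flat and symplectic for all $\epsilon\in\mathbb C^*$. Define endomorphisms $I,J,K$ of $T_X=\operatorname{im}(h)\oplus\operatorname{im}(v)$ by $$I\circ h=i\cdot h,\quad I\circ v=-i\cdot v,\qquad J\circ h=-v,\quad J\circ v=h,\qquad K\circ h=i\cdot v,\quad K\circ v=i\cdot h,$$ and a symmetric bilinear form $g$ on $T_X$ by $$g(h(u_1),v(u_2))=\tfrac12\,\omega(u_1,u_2),\qquad g(h(u_1),h(u_2))=0=g(v(u_1),v(u_2)).$$ Theorem. The form $g$ is a holomorphic metric (symmetric and non-degenerate) on $X$, and it admits a Levi-Civita connection $\nabla$ (torsion-free with $\nabla g=0$). The operators $I,J,K$ are all parallel for $\nabla$ if and only if the connection $h_\epsilon=h+\epsilon^{-1}v$ is flat and symplectic for all $\epsilon\in\mathbb C^*$. In particular, if $(\omega,h)$ is a pre-Joyce structure on $M$, then $(g,I,J,K)$ is a complex hyperkähler structure on $X=T_M$: $g$ is a holomorphic metric, $I,J,K$ are holomorphic endomorphisms of $T_X$ with $I^2=J^2=K^2=IJK=-1$,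 and for each $R\in\{I,J,K\}$ one has $g(R(u_1),R(u_2))=g(u_1,u_2)$ and $\nabla(R)=0$. -/

import Mathlib

open scoped Manifold ContDiff Topology

noncomputable section

namespace PreJoyce

/-! ### Holomorphic tensors and complex hyperkähler structures on a complex manifold

All tensors are families of (multi)linear maps on the holomorphic tangent spaces. Holomorphy and
all differential conditions are imposed on germs of holomorphic vector fields. -/

section General

variable {E : Type*} [NormedAddCommGroup E] [NormedSpace ℂ E]
  {H : Type*} [TopologicalSpace H] (I : ModelWithCorners ℂ E H)
  {X : Type*} [TopologicalSpace X] [ChartedSpace H X] [IsManifold I ω X]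

/-- The vector field `V` is holomorphic in a neighbourhood of `x`. -/
def HolomorphicFieldAt (V : Π x : X, TangentSpace I x) (x : X) : Prop :=
  ContMDiffAt I I.tangent ω (fun y => (⟨y, V y⟩ : TangentBundle I X)) x

/-- The field of bilinear forms `b` on the tangent spaces is holomorphic, that is, a map of sheaves
`T_X ⊗ T_X → O_X`. -/
def IsHolomorphicBilin (b : Π x : X, LinearMap.BilinForm ℂ (TangentSpace I x)) : Prop :=
  ∀ (x : X) (V W : Π x : X, TangentSpace I x),
    HolomorphicFieldAt I V x → HolomorphicFieldAt I W x →
      ContMDiffAt I 𝓘(ℂ) ω (fun y => b y (V y) (W y)) x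

/-- The field of endomorphisms `R` of the tangent spaces is holomorphic. -/
def IsHolomorphicEnd (R : Π x : X, Module.End ℂ (TangentSpace I x)) : Prop :=
  ∀ (x : X) (V : Π x : X, TangentSpace I x),
    HolomorphicFieldAt I V x → HolomorphicFieldAt I (fun y => R y (V y)) x

/-- The 2-form `σ` is closed: `dσ = 0`, with `dσ` computed by Cartan's formula. -/
def IsClosedForm (σ : Π x : X, LinearMap.BilinForm ℂ (TangentSpace I x)) : Prop :=
  ∀ (x : X) (U V W : Π x : X, TangentSpace I x),
    HolomorphicFieldAt I U x → HolomorphicFieldAt I V x → HolomorphicFieldAt I W x →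
      mvfderiv I (fun y => σ y (V y) (W y)) x (U x)
        + mvfderiv I (fun y => σ y (W y) (U y)) x (V x)
        + mvfderiv I (fun y => σ y (U y) (V y)) x (W x)
        - σ x (VectorField.mlieBracket I U V x) (W x)
        - σ x (VectorField.mlieBracket I V W x) (U x)
        - σ x (VectorField.mlieBracket I W U x) (V x) = 0

/-- Holomorphic symplectic forms. -/
structure IsHolomorphicSymplectic (σ : Π x : X, LinearMap.BilinForm ℂ (TangentSpace I x)) :
    Prop where
  holomorphic : IsHolomorphicBilin I σ
  alternating : ∀ (x : X) (u : TangentSpace I x), σ x u u = 0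
  nondegenerate : ∀ (x : X) (u : TangentSpace I x), (∀ u', σ x u u' = 0) → u = 0
  closed : IsClosedForm I σ

/-- Holomorphic metrics: symmetric non-degenerate holomorphic bilinear forms. -/
structure IsHolomorphicMetric (g : Π x : X, LinearMap.BilinForm ℂ (TangentSpace I x)) :
    Prop where
  holomorphic : IsHolomorphicBilin I g
  symmetric : ∀ (x : X) (u u' : TangentSpace I x), g x u u' = g x u' u
  nondegenerate : ∀ (x : X) (u : TangentSpace I x), (∀ u', g x u u' = 0) → u = 0

variable [FiniteDimensional ℂ E]

/-- The covariant derivative `cov` on the tangent bundle is a Levi-Civita connection for `g`: it is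
torsion-free, and `d (g (V, W)) = g (∇ V, W) + g (V, ∇ W)`.
Here `cov V x u` is `(∇_u V)(x)`. -/
structure IsLeviCivita (g : Π x : X, LinearMap.BilinForm ℂ (TangentSpace I x))
    (cov : CovariantDerivative I E (TangentSpace I : X → Type _)) : Prop where
  torsion_free :
    haveI : CompleteSpace E := FiniteDimensional.complete ℂ E
    cov.torsion = 0
  metric : ∀ (x : X) (V W : Π x : X, TangentSpace I x),
    MDifferentiableAt I I.tangent (fun y => (⟨y, V y⟩ : TangentBundle I X)) x →
    MDifferentiableAt I I.tangent (fun y => (⟨y, W y⟩ : TangentBundle I X)) x →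
    ∀ u : TangentSpace I x,
      mvfderiv I (fun y => g y (V y) (W y)) x u = g x (cov V x u) (W x) + g x (V x) (cov W x u)

/-- The field of endomorphisms `R` is parallel: `∇ (R V) = R (∇ V)`. -/
def IsParallel (cov : CovariantDerivative I E (TangentSpace I : X → Type _))
    (R : Π x : X, Module.End ℂ (TangentSpace I x)) : Prop :=
  ∀ (x : X) (V : Π x : X, TangentSpace I x),
    MDifferentiableAt I I.tangent (fun y => (⟨y, V y⟩ : TangentBundle I X)) x →
    ∀ u : TangentSpace I x, cov (fun y => R y (V y)) x u = R x (cov V x u)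

/-- Complex hyperkähler structures `(g, I, J, K)`, the endomorphisms being called `A, B, C`. -/
structure IsComplexHyperkahler (g : Π x : X, LinearMap.BilinForm ℂ (TangentSpace I x))
    (A B C : Π x : X, Module.End ℂ (TangentSpace I x)) : Prop where
  metric : IsHolomorphicMetric I g
  holomorphic_A : IsHolomorphicEnd I A
  holomorphic_B : IsHolomorphicEnd I B
  holomorphic_C : IsHolomorphicEnd I C
  sq_A : ∀ x, A x * A x = -1
  sq_B : ∀ x, B x * B x = -1
  sq_C : ∀ x, C x * C x = -1
  mul_ABC : ∀ x, A x * B x * C x = -1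
  isometry_A : ∀ (x : X) (u u' : TangentSpace I x), g x (A x u) (A x u') = g x u u'
  isometry_B : ∀ (x : X) (u u' : TangentSpace I x), g x (B x u) (B x u') = g x u u'
  isometry_C : ∀ (x : X) (u u' : TangentSpace I x), g x (C x u) (C x u') = g x u u'
  parallel : ∃ cov : CovariantDerivative I E (TangentSpace I : X → Type _),
    IsLeviCivita I g cov ∧ IsParallel I cov A ∧ IsParallel I cov B ∧ IsParallel I cov C

end General

/-! ### The total space of the tangent bundle -/

section TangentBundle

variable {E : Type*} [NormedAddCommGroup E] [NormedSpace ℂ E]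
  {M : Type*} [TopologicalSpace M] [ChartedSpace E M] [IsManifold 𝓘(ℂ, E) ω M]

/-- The inclusion of the fibre `T_m M` (which is the vector space `E`) in the total space. -/
def fibreIncl (m : M) (y : E) : TangentBundle 𝓘(ℂ, E) M := ⟨m, y⟩

/-- The canonical map `v : π^* T_M → T_X` on `X = T_M`, identifying `T_m M` with the tangent space
of the fibre of `π` at the point `x` over `m`: it is the derivative at `x` of the inclusion of
the fibre. -/
def vert (x : TangentBundle 𝓘(ℂ, E) M) :
    TangentSpace 𝓘(ℂ, E) x.proj →ₗ[ℂ] TangentSpace 𝓘(ℂ, E).tangent x :=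
  (mfderiv 𝓘(ℂ, E) 𝓘(ℂ, E).tangent (fibreIncl (E := E) x.proj) (show E from x.snd)).toLinearMap

/-- The derivative `π_* : T_X → π^* T_M` of the projection `π : X = T_M → M`. -/
def projDeriv (x : TangentBundle 𝓘(ℂ, E) M) :
    TangentSpace 𝓘(ℂ, E).tangent x →ₗ[ℂ] TangentSpace 𝓘(ℂ, E) x.proj :=
  (mfderiv 𝓘(ℂ, E).tangent 𝓘(ℂ, E) Bundle.TotalSpace.proj x).toLinearMap

/-- The coordinates of tangent vectors at `m` in the preferred chart around `m₀`. -/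
def coordAt (m₀ m : M) : E →L[ℂ] E :=
  (trivializationAt E (TangentSpace 𝓘(ℂ, E)) m₀).continuousLinearMapAt ℂ m

theorem coordAt_apply {m₀ m : M} (hm : m ∈ (chartAt E m₀).source) (u : E) :
    coordAt m₀ m u = (trivializationAt E (TangentSpace 𝓘(ℂ, E)) m₀ (fibreIncl m u)).2 := by
  unfold coordAt fibreIncl
  refine (Bundle.Trivialization.linearMapAt_apply _ (R := ℂ) _).trans ?_
  rw [if_pos (by simpa using hm)]

theorem contMDiff_fibreIncl (m : M) : ContMDiff 𝓘(ℂ, E) 𝓘(ℂ, E).tangent ω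
    (fibreIncl (E := E) m) := by
  intro y
  rw [Bundle.contMDiffAt_totalSpace]
  refine ⟨contMDiffAt_const, ?_⟩
  refine ((coordAt m m).contMDiff (n := ω) y).congr_of_eventuallyEq (.of_forall fun z => ?_)
  exact (coordAt_apply (mem_chart_source _ _) z).symm

theorem extChartAt_vert (x₀ y : TangentBundle 𝓘(ℂ, E) M)
    (hy : y.proj ∈ (chartAt E x₀.proj).source) (u : TangentSpace 𝓘(ℂ, E) y.proj) :
    mfderiv 𝓘(ℂ, E).tangent 𝓘(ℂ, E × E) (extChartAt 𝓘(ℂ, E).tangent x₀) y (vert y u)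
      = ((0 : E), coordAt (E := E) x₀.proj y.proj u) := by
  have h1 : MDifferentiableAt 𝓘(ℂ, E).tangent 𝓘(ℂ, E × E) (extChartAt 𝓘(ℂ, E).tangent x₀)
      (fibreIncl y.proj y.snd) :=
    mdifferentiableAt_extChartAt (by simpa [fibreIncl] using hy)
  have h2 := ((contMDiff_fibreIncl (E := E) y.proj) (show E from y.snd)).mdifferentiableAt (by simp)
  refine (mfderiv_comp_apply (show E from y.snd) h1 h2 u).symm.trans ?_
  have h4 : (extChartAt 𝓘(ℂ, E).tangent x₀ ∘ fibreIncl (E := E) y.proj)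
    = fun z : E => (extChartAt 𝓘(ℂ, E) x₀.proj y.proj, coordAt x₀.proj y.proj z) := by
    funext z
    rw [Function.comp_apply, coordAt_apply hy, FiberBundle.extChartAt]
    rfl
  have h5 : HasFDerivAt (fun z : E => (extChartAt 𝓘(ℂ, E) x₀.proj y.proj,
      coordAt x₀.proj y.proj z)) (ContinuousLinearMap.prod 0 (coordAt x₀.proj y.proj)) y.snd :=
    (hasFDerivAt_const _ _).prodMk (ContinuousLinearMap.hasFDerivAt _)
  rw [h4, mfderiv_eq_fderiv, h5.fderiv]
  rfl

theorem projDeriv_vert (x : TangentBundle 𝓘(ℂ, E) M) (u : TangentSpace 𝓘(ℂ, E) x.proj) :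
    projDeriv x (vert x u) = 0 := by
  have h1 : MDifferentiableAt 𝓘(ℂ, E).tangent 𝓘(ℂ, E)
      (Bundle.TotalSpace.proj : TangentBundle 𝓘(ℂ, E) M → M) (fibreIncl x.proj x.snd) :=
    (Bundle.contMDiffAt_proj (TangentSpace 𝓘(ℂ, E)) (n := ω)).mdifferentiableAt (by simp)
  have h2 := ((contMDiff_fibreIncl (E := E) x.proj) (show E from x.snd)).mdifferentiableAt (by simp)
  refine (mfderiv_comp_apply (show E from x.snd) h1 h2 u).symm.trans ?_
  have : ((Bundle.TotalSpace.proj : TangentBundle 𝓘(ℂ, E) M → M) ∘ fibreIncl (E := E) x.proj) =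
    fun _ => x.proj := rfl
  rw [this, mfderiv_const]
  rfl

theorem vert_injective (x : TangentBundle 𝓘(ℂ, E) M) : Function.Injective (vert x) := by
  rw [injective_iff_map_eq_zero]
  intro u hu
  have h := extChartAt_vert x x (mem_chart_source _ _) u
  rw [hu, map_zero] at h
  have h' : coordAt (E := E) x.proj x.proj u = 0 := (congrArg Prod.snd h).symm
  have h3 := (trivializationAt E (TangentSpace 𝓘(ℂ, E)) x.proj).symmL_continuousLinearMapAt
    (R := ℂ) (FiberBundle.mem_baseSet_trivializationAt' x.proj) u
  rw [← h3]
  exact (congrArg _ h').trans (map_zero _)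

theorem holomorphicFieldAt_vert {x : TangentBundle 𝓘(ℂ, E) M} {u : Π m : M, TangentSpace 𝓘(ℂ, E) m}
    (hu : HolomorphicFieldAt 𝓘(ℂ, E) u x.proj) :
    HolomorphicFieldAt 𝓘(ℂ, E).tangent (fun y : TangentBundle 𝓘(ℂ, E) M => vert y (u y.proj)) x := by
  unfold HolomorphicFieldAt at hu ⊢
  rw [Bundle.contMDiffAt_section] at hu ⊢
  have h1 := hu.comp x (Bundle.contMDiffAt_proj (TangentSpace 𝓘(ℂ, E)) (n := ω))
  have h2 : ContMDiffAt 𝓘(ℂ, E).tangent 𝓘(ℂ, E × E) ω (fun y : TangentBundle 𝓘(ℂ, E) M =>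
    ((0 : E), (trivializationAt E (TangentSpace 𝓘(ℂ, E)) x.proj ⟨y.proj, u y.proj⟩).2)) x :=
    contMDiffAt_const.prodMk_space h1
  refine h2.congr_of_eventuallyEq ?_
  have : (Bundle.TotalSpace.proj : TangentBundle 𝓘(ℂ, E) M → M) ⁻¹' (chartAt E x.proj).source
      ∈ 𝓝 x :=
    (FiberBundle.continuous_proj E _).continuousAt.preimage_mem_nhds (chart_source_mem_nhds _ _)
  filter_upwards [this] with y hy
  have h3 := (extChartAt_vert x y hy (u y.proj)).trans
    (congrArg (Prod.mk (0 : E)) (coordAt_apply hy _))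
  refine Eq.trans ?_ h3
  rw [← TangentBundle.continuousLinearMapAt_trivializationAt (by simpa using hy)]
  have h4 : (trivializationAt (E × E) (TangentSpace 𝓘(ℂ, E).tangent) x).continuousLinearMapAt ℂ y
      (vert y (u y.proj)) = (trivializationAt (E × E) (TangentSpace 𝓘(ℂ, E).tangent) x
        ⟨y, vert y (u y.proj)⟩).2 := by
    refine (Bundle.Trivialization.linearMapAt_apply _ (R := ℂ) _).trans ?_
    rw [if_pos (by simpa using hy)]
  exact h4.symm

variable (E M) in
/-- A (holomorphic) non-linear connection on `π : X = T_M → M`: a bundle map `h : π^* T_M → T_X`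
with `π_* ∘ h = 1`. Holomorphy is tested on the sections of `π^* T_M` pulled back from `M`, which
generate it. -/
structure NonlinearConnection where
  /-- the horizontal lift at `x` of tangent vectors of `M` at `π x` -/
  lift : Π x : TangentBundle 𝓘(ℂ, E) M,
    TangentSpace 𝓘(ℂ, E) x.proj →ₗ[ℂ] TangentSpace 𝓘(ℂ, E).tangent x
  proj_lift : ∀ x u, projDeriv x (lift x u) = u
  holomorphic : ∀ (x : TangentBundle 𝓘(ℂ, E) M) (u : Π m : M, TangentSpace 𝓘(ℂ, E) m),
    HolomorphicFieldAt 𝓘(ℂ, E) u x.proj →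
      HolomorphicFieldAt 𝓘(ℂ, E).tangent (fun y => lift y (u y.proj)) x

namespace NonlinearConnection

/-- The connection `h_ε = h + ε⁻¹ v` (used for `ε ≠ 0`). -/
def pencil (h : NonlinearConnection E M) (ε : ℂ) : NonlinearConnection E M where
  lift x := h.lift x + ε⁻¹ • vert x
  proj_lift x u := by simp [h.proj_lift, projDeriv_vert]
  holomorphic x u hu := by
    have h1 := h.holomorphic x u hu
    have h2 := holomorphicFieldAt_vert hu
    exact h1.add_section (h2.const_smul_section (a := ε⁻¹))

/-- The horizontal sub-bundle `im h`. -/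
def horizontal (h : NonlinearConnection E M) (x : TangentBundle 𝓘(ℂ, E) M) :
    Submodule ℂ (TangentSpace 𝓘(ℂ, E).tangent x) :=
  LinearMap.range (h.lift x)

/-- The connection is flat: the horizontal sub-bundle is closed under Lie bracket. -/
def IsFlat (h : NonlinearConnection E M) : Prop :=
  ∀ (x : TangentBundle 𝓘(ℂ, E) M)
    (V W : Π x : TangentBundle 𝓘(ℂ, E) M, TangentSpace 𝓘(ℂ, E).tangent x),
    HolomorphicFieldAt 𝓘(ℂ, E).tangent V x → HolomorphicFieldAt 𝓘(ℂ, E).tangent W x →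
    (∀ᶠ y in 𝓝 x, V y ∈ h.horizontal y) → (∀ᶠ y in 𝓝 x, W y ∈ h.horizontal y) →
      VectorField.mlieBracket 𝓘(ℂ, E).tangent V W x ∈ h.horizontal x

variable [FiniteDimensional ℂ E]

/-- The decomposition `T_X = im h ⊕ im v ≅ π^* T_M ⊕ π^* T_M`, given by
`(a, b) ↦ h a + v b`. -/
def split (h : NonlinearConnection E M) (x : TangentBundle 𝓘(ℂ, E) M) :
    (TangentSpace 𝓘(ℂ, E) x.proj × TangentSpace 𝓘(ℂ, E) x.proj) ≃ₗ[ℂ]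
      TangentSpace 𝓘(ℂ, E).tangent x :=
  haveI : FiniteDimensional ℂ (TangentSpace 𝓘(ℂ, E) x.proj) :=
    inferInstanceAs (FiniteDimensional ℂ E)
  haveI : FiniteDimensional ℂ (TangentSpace 𝓘(ℂ, E).tangent x) :=
    inferInstanceAs (FiniteDimensional ℂ (E × E))
  LinearEquiv.ofInjectiveOfFinrankEq ((h.lift x).coprod (vert x))
    (by
      rw [injective_iff_map_eq_zero]
      rintro ⟨a, b⟩ hab
      rw [LinearMap.coprod_apply] at hab
      have ha : a = 0 := by
        simpa [h.proj_lift, projDeriv_vert] using congrArg (projDeriv x) hab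
      subst ha
      rw [map_zero, zero_add] at hab
      exact Prod.ext rfl (vert_injective x (hab.trans (map_zero _).symm)))
    rfl

theorem split_apply (h : NonlinearConnection E M) (x : TangentBundle 𝓘(ℂ, E) M)
    (a b : TangentSpace 𝓘(ℂ, E) x.proj) : h.split x (a, b) = h.lift x a + vert x b := rfl

/-- The map `T_X → π^* T_M`, `h a + v b ↦ a` (this is `π_*`). -/
def hPart (h : NonlinearConnection E M) (x : TangentBundle 𝓘(ℂ, E) M) :
    TangentSpace 𝓘(ℂ, E).tangent x →ₗ[ℂ] TangentSpace 𝓘(ℂ, E) x.proj :=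
  LinearMap.fst ℂ _ _ ∘ₗ (h.split x).symm.toLinearMap

/-- The map `T_X → π^* T_M`, `h a + v b ↦ b`. -/
def vPart (h : NonlinearConnection E M) (x : TangentBundle 𝓘(ℂ, E) M) :
    TangentSpace 𝓘(ℂ, E).tangent x →ₗ[ℂ] TangentSpace 𝓘(ℂ, E) x.proj :=
  LinearMap.snd ℂ _ _ ∘ₗ (h.split x).symm.toLinearMap

/-- The unique 2-form `Ω` on `X` with kernel `im h` and `Ω (v a, v b) = σ (a, b)`: the extension
along `h` of the relative symplectic form `Ω_π` which `σ` induces on the fibres of `π`. -/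
def relativeForm (h : NonlinearConnection E M)
    (σ : Π m : M, LinearMap.BilinForm ℂ (TangentSpace 𝓘(ℂ, E) m))
    (x : TangentBundle 𝓘(ℂ, E) M) : LinearMap.BilinForm ℂ (TangentSpace 𝓘(ℂ, E).tangent x) :=
  (σ x.proj).compl₁₂ (h.vPart x) (h.vPart x)

/-- The connection is symplectic, i.e. preserves the relative symplectic form `Ω_π`: the Lie
derivative `L_u Ω_π` vanishes on vertical vectors, for every horizontal vector field `u`. -/
def IsSymplectic (h : NonlinearConnection E M)
    (σ : Π m : M, LinearMap.BilinForm ℂ (TangentSpace 𝓘(ℂ, E) m)) : Prop :=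
  ∀ (x : TangentBundle 𝓘(ℂ, E) M)
    (U V W : Π x : TangentBundle 𝓘(ℂ, E) M, TangentSpace 𝓘(ℂ, E).tangent x),
    HolomorphicFieldAt 𝓘(ℂ, E).tangent U x → HolomorphicFieldAt 𝓘(ℂ, E).tangent V x →
    HolomorphicFieldAt 𝓘(ℂ, E).tangent W x →
    (∀ᶠ y in 𝓝 x, U y ∈ h.horizontal y) →
    (∀ᶠ y in 𝓝 x, projDeriv y (V y) = 0) → (∀ᶠ y in 𝓝 x, projDeriv y (W y) = 0) →
      mvfderiv 𝓘(ℂ, E).tangent (fun y => h.relativeForm σ y (V y) (W y)) x (U x)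
        - h.relativeForm σ x (VectorField.mlieBracket 𝓘(ℂ, E).tangent U V x) (W x)
        - h.relativeForm σ x (V x) (VectorField.mlieBracket 𝓘(ℂ, E).tangent U W x) = 0

/-- `(σ, h)` is a pre-Joyce structure on `M`. -/
def IsPreJoyce (h : NonlinearConnection E M)
    (σ : Π m : M, LinearMap.BilinForm ℂ (TangentSpace 𝓘(ℂ, E) m)) : Prop :=
  IsHolomorphicSymplectic 𝓘(ℂ, E) σ ∧
    ∀ ε : ℂ, ε ≠ 0 → (h.pencil ε).IsFlat ∧ (h.pencil ε).IsSymplectic σ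

/-- The endomorphism `I` of `T_X`: `I ∘ h = i h` and `I ∘ v = - i v`. -/
def opI (h : NonlinearConnection E M) (x : TangentBundle 𝓘(ℂ, E) M) :
    Module.End ℂ (TangentSpace 𝓘(ℂ, E).tangent x) :=
  Complex.I • (h.lift x ∘ₗ h.hPart x) - Complex.I • (vert x ∘ₗ h.vPart x)

/-- The endomorphism `J` of `T_X`: `J ∘ h = - v` and `J ∘ v = h`. -/
def opJ (h : NonlinearConnection E M) (x : TangentBundle 𝓘(ℂ, E) M) :
    Module.End ℂ (TangentSpace 𝓘(ℂ, E).tangent x) :=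
  - (vert x ∘ₗ h.hPart x) + h.lift x ∘ₗ h.vPart x

/-- The endomorphism `K` of `T_X`: `K ∘ h = i v` and `K ∘ v = i h`. -/
def opK (h : NonlinearConnection E M) (x : TangentBundle 𝓘(ℂ, E) M) :
    Module.End ℂ (TangentSpace 𝓘(ℂ, E).tangent x) :=
  Complex.I • (vert x ∘ₗ h.hPart x) + Complex.I • (h.lift x ∘ₗ h.vPart x)

/-- The metric on `X`: `g (h a, v b) = g (v b, h a) = σ (a, b) / 2`, and
`g (h a, h b) = 0 = g (v a, v b)`. -/
def metric (h : NonlinearConnection E M)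
    (σ : Π m : M, LinearMap.BilinForm ℂ (TangentSpace 𝓘(ℂ, E) m))
    (x : TangentBundle 𝓘(ℂ, E) M) : LinearMap.BilinForm ℂ (TangentSpace 𝓘(ℂ, E).tangent x) :=
  (1 / 2 : ℂ) • ((σ x.proj).compl₁₂ (h.hPart x) (h.vPart x)
    + ((σ x.proj).compl₁₂ (h.hPart x) (h.vPart x)).flip)

section Formulas

variable (h : NonlinearConnection E M)
  (σ : Π m : M, LinearMap.BilinForm ℂ (TangentSpace 𝓘(ℂ, E) m))
  (x : TangentBundle 𝓘(ℂ, E) M) (a b : TangentSpace 𝓘(ℂ, E) x.proj)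

theorem split_symm_lift : (h.split x).symm (h.lift x a) = (a, 0) := by
  rw [LinearEquiv.symm_apply_eq, split_apply, map_zero, add_zero]

theorem split_symm_vert : (h.split x).symm (vert x a) = (0, a) := by
  rw [LinearEquiv.symm_apply_eq, split_apply, map_zero, zero_add]

theorem hPart_lift : h.hPart x (h.lift x a) = a := congrArg Prod.fst (h.split_symm_lift x a)

theorem hPart_vert : h.hPart x (vert x a) = 0 := congrArg Prod.fst (h.split_symm_vert x a)

theorem vPart_lift : h.vPart x (h.lift x a) = 0 := congrArg Prod.snd (h.split_symm_lift x a)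

theorem vPart_vert : h.vPart x (vert x a) = a := congrArg Prod.snd (h.split_symm_vert x a)

theorem opI_lift : h.opI x (h.lift x a) = Complex.I • h.lift x a := by
  simp [opI, hPart_lift, vPart_lift]

theorem opI_vert : h.opI x (vert x a) = -(Complex.I • vert x a) := by
  simp [opI, hPart_vert, vPart_vert]

theorem opJ_lift : h.opJ x (h.lift x a) = - vert x a := by
  simp [opJ, hPart_lift, vPart_lift]

theorem opJ_vert : h.opJ x (vert x a) = h.lift x a := by
  simp [opJ, hPart_vert, vPart_vert]

theorem opK_lift : h.opK x (h.lift x a) = Complex.I • vert x a := by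
  simp [opK, hPart_lift, vPart_lift]

theorem opK_vert : h.opK x (vert x a) = Complex.I • h.lift x a := by
  simp [opK, hPart_vert, vPart_vert]

theorem metric_lift_vert : h.metric σ x (h.lift x a) (vert x b) = 1 / 2 * σ x.proj a b := by
  simp [metric, hPart_lift, hPart_vert, vPart_lift, vPart_vert]

theorem metric_vert_lift : h.metric σ x (vert x b) (h.lift x a) = 1 / 2 * σ x.proj a b := by
  simp [metric, hPart_lift, hPart_vert, vPart_lift, vPart_vert]

theorem metric_lift_lift : h.metric σ x (h.lift x a) (h.lift x b) = 0 := by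
  simp [metric, hPart_lift, vPart_lift]

theorem metric_vert_vert : h.metric σ x (vert x a) (vert x b) = 0 := by
  simp [metric, hPart_vert, vPart_vert]

end Formulas

end NonlinearConnection

end TangentBundle

end PreJoyce

end

/-!
Vector fields `a`, `b` on `M` lift to fields `h a` and `v a` on `X = T_M`. Everything is read off
from the brackets of such lifts: `[v a, v b] = 0`, as vertical lifts are constant on the fibres;
`[h a, v b] = v (Γ (a, b))` is vertical (`Γ` is called `vertBracket`); and `[h a, h b]` projects to
`[a, b]`. Flatness and preservation of the relative symplectic form are tensorial conditions, so
that they need to be tested on lifts only (`isFlat_iff`, `isSymplectic_iff`). Expanding the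
brackets of the lifts `h a + ε⁻¹ v a` in powers of `ε⁻¹` shows that the whole pencil is flat if and
only if `h` is flat and `Γ (a, b) - Γ (b, a) = [a, b]` (`forall_isFlat_pencil_iff`), and that `h_ε`
is symplectic if and only if `h` is (`isSymplectic_pencil_iff`).

The Levi-Civita connection exists by the Koszul formula (`IsHolomorphicMetric.exists_isLeviCivita`).
Both sides of the equivalence are compared with the following explicit shape of it
(`IsBracketConnection`):
`∇_{h c} (h a) = h (Γ (c, a))`, `∇_{h c} (v a) = v (Γ (c, a))`, `∇_{v c} (h a) = 0 = ∇_{v c} (v a)`.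
* If the pencil is flat and symplectic, evaluating the Koszul formula on lifts yields this shape.
  In particular `∇` acts on `T_X = π^* T_M ⊗ ℂ²` through the first factor (`IsDiagonal`), so that
  it commutes with the endomorphisms `I`, `J`, `K`, which are constant on the second factor.
* If `I` and `J` are parallel, `∇` preserves the eigenbundle `im h` of `I`, and acts in the same way
  on `im v = J (im h)`. Comparing the horizontal and vertical parts in
  `∇_{h a} (v b) - ∇_{v b} (h a) = [h a, v b]` gives the above shape; then the vanishing of the
  torsion on `h a`, `h b` says that `h` is flat and `Γ (a, b) - Γ (b, a) = [a, b]`, while `∇ g = 0`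
  on `h a`, `v b` says that `h` is symplectic.
-/

noncomputable section

namespace PreJoyce

/-! ### Lie brackets of vector fields and differentiable maps -/

section Brackets
open VectorField Set
variable {E : Type*} [NormedAddCommGroup E] [NormedSpace ℂ E] [CompleteSpace E]
  {H : Type*} [TopologicalSpace H] {I : ModelWithCorners ℂ E H} [I.Boundaryless]
  {X : Type*} [TopologicalSpace X] [ChartedSpace H X] [IsManifold I ω X]
  {F : Type*} [NormedAddCommGroup F] [NormedSpace ℂ F]

omit [CompleteSpace E] [I.Boundaryless] in
theorem trivializationAt_snd {x₀ y : X} (hy : y ∈ (chartAt H x₀).source) (u : TangentSpace I y) :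
    (trivializationAt E (TangentSpace I) x₀ ⟨y, u⟩).2
      = mvfderiv I (extChartAt I x₀) y u := by
  have h : (trivializationAt E (TangentSpace I) x₀).continuousLinearMapAt ℂ y u
      = (trivializationAt E (TangentSpace I) x₀ ⟨y, u⟩).2 := by
    refine (Bundle.Trivialization.linearMapAt_apply _ (R := ℂ) _).trans ?_
    rw [if_pos (by simpa using hy)]
  exact h.symm.trans
    (DFunLike.congr_fun (TangentBundle.continuousLinearMapAt_trivializationAt hy) u)

/-- The bracket of two vector fields is the commutator of the derivations they define. The proof
transports the corresponding statement for the bracket in `E` through the preferred chart. -/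
theorem mvfderiv_mlieBracket {f : X → F} {x : X} {V W : Π x : X, TangentSpace I x}
    (hf : ContMDiffAt I 𝓘(ℂ, F) 2 f x)
    (hV : MDifferentiableAt I I.tangent (fun y => (⟨y, V y⟩ : TangentBundle I X)) x)
    (hW : MDifferentiableAt I I.tangent (fun y => (⟨y, W y⟩ : TangentBundle I X)) x) :
    mvfderiv I f x (mlieBracket I V W x) =
      mvfderiv I (fun y => mvfderiv I f y (W y)) x (V x)
        - mvfderiv I (fun y => mvfderiv I f y (V y)) x (W x) := by
  set φ := extChartAt I x with hφ
  set f' : E → F := f ∘ φ.symm with hf'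
  set P : (Π x : X, TangentSpace I x) → E → E := fun U =>
    mpullbackWithin 𝓘(ℂ, E) I φ.symm U (range I) with hP
  have hrange : range I = univ := I.range_eq_univ
  have hPd : ∀ U : Π x : X, TangentSpace I x,
      MDifferentiableAt I I.tangent (fun y => (⟨y, U y⟩ : TangentBundle I X)) x →
      DifferentiableAt ℂ (P U) (φ x) := by
    intro U hU
    have := (mdifferentiableWithinAt_univ.2 hU).differentiableWithinAt_mpullbackWithin_vectorField
    rw [preimage_univ, univ_inter] at this
    exact this.differentiableAt (by rw [hrange]; exact Filter.univ_mem)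
  have hf'C : ContDiffAt ℂ 2 f' (φ x) := by
    rw [← contMDiffAt_iff_contDiffAt]
    refine ContMDiffAt.comp_of_eq (I' := I) hf ?_ (extChartAt_to_inv x)
    have := contMDiffWithinAt_extChartAt_symm_range (I := I) (n := 2) x (mem_extChartAt_target x)
    exact this.contMDiffAt (by rw [hrange]; exact Filter.univ_mem)
  -- the chart intertwines a field with its representative
  have hPφ : ∀ U : Π x : X, TangentSpace I x, ∀ y ∈ φ.source,
      mfderiv I 𝓘(ℂ, E) φ y (U y) = P U (φ y) := by
    intro U y hy
    have h : ∀ z ∈ φ.target, mfderiv I 𝓘(ℂ, E) φ (φ.symm z) (U (φ.symm z)) = P U z := by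
      intro z hz
      rw [hP]
      simp only [mpullbackWithin_apply]
      rw [ContinuousLinearMap.inverse_eq
        (mfderivWithin_extChartAt_symm_comp_mfderiv_extChartAt hz)
        (mfderiv_extChartAt_comp_mfderivWithin_extChartAt_symm hz)]
      rfl
    have h' := h (φ y) (φ.map_source hy)
    rwa [φ.left_inv hy] at h'
  -- and derivatives of `f` are those of its representative `f'`
  have hfP : ∀ U : Π x : X, TangentSpace I x, ∀ᶠ y in 𝓝 x,
      mvfderiv I f y (U y) = fderiv ℂ f' (φ y) (P U (φ y)) := by
    intro U
    filter_upwards [(continuousAt_extChartAt (I := I) x).eventually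
      (hf'C.eventually (by simp)), extChartAt_source_mem_nhds (I := I) x] with y hy hys
    have h1 : f =ᶠ[𝓝 y] f' ∘ φ := by
      filter_upwards [extChartAt_source_mem_nhds' (I := I) hys] with z hz
      exact congrArg f ((extChartAt I x).left_inv hz).symm
    rw [← hPφ _ y hys, ← mfderiv_eq_fderiv, mvfderiv, h1.mfderiv_eq]
    exact mfderiv_comp_apply y (hy.differentiableAt (by simp)).mdifferentiableAt
      (mdifferentiableAt_extChartAt (by simpa using hys)) (U y)
  -- hence second derivatives along fields may be computed in the chart
  have hD : ∀ U U' : Π x : X, TangentSpace I x,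
      MDifferentiableAt I I.tangent (fun y => (⟨y, U y⟩ : TangentBundle I X)) x →
      mvfderiv I (fun y => mvfderiv I f y (U y)) x (U' x)
        = fderiv ℂ (fun z => fderiv ℂ f' z (P U z)) (φ x) (P U' (φ x)) := by
    intro U U' hU
    have h1 : DifferentiableAt ℂ (fun z => fderiv ℂ f' z (P U z)) (φ x) :=
      ((hf'C.fderiv_right (m := 1) (by norm_num)).differentiableAt (by simp)).clm_apply (hPd U hU)
    have h2 : (fun y => mvfderiv I f y (U y)) =ᶠ[𝓝 x] (fun z => fderiv ℂ f' z (P U z)) ∘ φ := hfP U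
    rw [← hPφ _ x (mem_extChartAt_source x), ← mfderiv_eq_fderiv, mvfderiv, h2.mfderiv_eq]
    exact mfderiv_comp_apply x h1.mdifferentiableAt
      (mdifferentiableAt_extChartAt (mem_chart_source _ _)) (U' x)
  rw [hD W V hW, hD V W hV, ← fderiv_apply_lieBracket hf'C (by simp) (hPd W hW) (hPd V hV)]
  rw [(hfP (mlieBracket I V W)).self_of_nhds]
  congr 1
  rw [← hPφ _ x (mem_extChartAt_source x)]
  have h : ∀ L : E, lieBracketWithin ℂ (P V) (P W) (range I) (φ x) = L →
      (mfderiv I 𝓘(ℂ, E) φ x).inverse L = mlieBracket I V W x := by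
    rintro L rfl
    rw [← mlieBracketWithin_univ, mlieBracketWithin_apply, preimage_univ, univ_inter]
  rw [hrange, lieBracketWithin_univ] at h
  exact ((isInvertible_mfderiv_extChartAt (mem_extChartAt_source x)).inverse_apply_eq.1
    (h _ rfl)).symm

variable {E' : Type*} [NormedAddCommGroup E'] [NormedSpace ℂ E'] [CompleteSpace E']
  {H' : Type*} [TopologicalSpace H'] {I' : ModelWithCorners ℂ E' H'} [I'.Boundaryless]
  {Y : Type*} [TopologicalSpace Y] [ChartedSpace H' Y] [IsManifold I' ω Y]

/-- If `V`, `W` are `f`-related to `V'`, `W'`, then `[V, W]` is `f`-related to `[V', W']`. No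
invertibility is asked of the derivative of `f`. -/
theorem mfderiv_mlieBracket_of_related {f : X → Y} {x : X} {V W : Π x : X, TangentSpace I x}
    {V' W' : Π y : Y, TangentSpace I' y}
    (hf : ContMDiffAt I I' 2 f x)
    (hV : MDifferentiableAt I I.tangent (fun y => (⟨y, V y⟩ : TangentBundle I X)) x)
    (hW : MDifferentiableAt I I.tangent (fun y => (⟨y, W y⟩ : TangentBundle I X)) x)
    (hV' : MDifferentiableAt I' I'.tangent (fun y => (⟨y, V' y⟩ : TangentBundle I' Y)) (f x))
    (hW' : MDifferentiableAt I' I'.tangent (fun y => (⟨y, W' y⟩ : TangentBundle I' Y)) (f x))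
    (hVV' : ∀ᶠ y in 𝓝 x, mfderiv I I' f y (V y) = V' (f y))
    (hWW' : ∀ᶠ y in 𝓝 x, mfderiv I I' f y (W y) = W' (f y)) :
    mfderiv I I' f x (mlieBracket I V W x) = mlieBracket I' V' W' (f x) := by
  set ψ := extChartAt I' (f x) with hψ
  have hψC : ContMDiffAt I' 𝓘(ℂ, E') 2 ψ (f x) := contMDiffAt_extChartAt
  have hfd : MDifferentiableAt I I' f x := hf.mdifferentiableAt (by simp)
  have hψd : MDifferentiableAt I' 𝓘(ℂ, E') ψ (f x) := hψC.mdifferentiableAt (by simp)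
  -- the derivative of the chart along a field of `Y`, a differentiable function
  have hψU : ∀ U : Π y : Y, TangentSpace I' y,
      MDifferentiableAt I' I'.tangent (fun y => (⟨y, U y⟩ : TangentBundle I' Y)) (f x) →
      MDifferentiableAt I' 𝓘(ℂ, E') (fun y => mvfderiv I' ψ y (U y)) (f x) := by
    intro U hU
    refine ((mdifferentiableAt_section _ _).1 hU).congr_of_eventuallyEq ?_
    filter_upwards [chart_source_mem_nhds H' (f x)] with y hy
    exact (trivializationAt_snd hy _).symm
  have hrel : ∀ (U : Π x : X, TangentSpace I x) (U' : Π y : Y, TangentSpace I' y),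
      (∀ᶠ y in 𝓝 x, mfderiv I I' f y (U y) = U' (f y)) →
      (fun y => mvfderiv I (ψ ∘ f) y (U y)) =ᶠ[𝓝 x] (fun y => mvfderiv I' ψ y (U' y)) ∘ f := by
    intro U U' hUU'
    filter_upwards [hUU', (contMDiffAt_iff_contMDiffAt_nhds (by simp)).1 hf,
      hf.continuousAt.eventually ((contMDiffAt_iff_contMDiffAt_nhds (by simp)).1 hψC)] with y hy hfy hψy
    rw [Function.comp_apply, ← hy]
    exact mfderiv_comp_apply y (hψy.mdifferentiableAt (by simp)) (hfy.mdifferentiableAt (by simp)) _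
  have hD : ∀ (U U₁ : Π x : X, TangentSpace I x) (U' U₁' : Π y : Y, TangentSpace I' y),
      MDifferentiableAt I' I'.tangent (fun y => (⟨y, U' y⟩ : TangentBundle I' Y)) (f x) →
      (∀ᶠ y in 𝓝 x, mfderiv I I' f y (U y) = U' (f y)) →
      (∀ᶠ y in 𝓝 x, mfderiv I I' f y (U₁ y) = U₁' (f y)) →
      mvfderiv I (fun y => mvfderiv I (ψ ∘ f) y (U y)) x (U₁ x)
        = mvfderiv I' (fun y => mvfderiv I' ψ y (U' y)) (f x) (U₁' (f x)) := by
    intro U U₁ U' U₁' hU' h h₁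
    rw [← h₁.self_of_nhds, mvfderiv, (hrel U U' h).mfderiv_eq]
    exact mfderiv_comp_apply x (hψU U' hU') hfd _
  have h1 := mvfderiv_mlieBracket (hψC.comp x hf) hV hW
  rw [hD W V W' V' hW' hWW' hVV', hD V W V' W' hV' hVV' hWW', ← mvfderiv_mlieBracket hψC hV' hW']
    at h1
  have h2 : mvfderiv I (ψ ∘ f) x (mlieBracket I V W x)
      = mvfderiv I' ψ (f x) (mfderiv I I' f x (mlieBracket I V W x)) :=
    mfderiv_comp_apply x hψd hfd _
  exact (isInvertible_mfderiv_extChartAt (mem_extChartAt_source (f x))).injective (h2.symm.trans h1)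
end Brackets

/-! ### Coordinate frames -/

section Frames
variable {E : Type*} [NormedAddCommGroup E] [NormedSpace ℂ E]
  {H : Type*} [TopologicalSpace H] {I : ModelWithCorners ℂ E H}
  {X : Type*} [TopologicalSpace X] [ChartedSpace H X] [IsManifold I ω X]

variable (I) in
/-- The vector field `V` is complex differentiable at the point `x`. -/
abbrev DifferentiableFieldAt (V : Π x : X, TangentSpace I x) (x : X) : Prop :=
  MDifferentiableAt I I.tangent (fun y => (⟨y, V y⟩ : TangentBundle I X)) x

theorem HolomorphicFieldAt.differentiable {V : Π x : X, TangentSpace I x} {x : X}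
    (hV : HolomorphicFieldAt I V x) : DifferentiableFieldAt I V x :=
  ContMDiffAt.mdifferentiableAt hV (by simp)

variable (I) in
/-- The vector field around `x₀` which is constant, equal to `e`, in the preferred chart. -/
def constField (x₀ : X) (e : E) (y : X) : TangentSpace I y :=
  (trivializationAt E (TangentSpace I) x₀).symmL ℂ y e

theorem constField_mvfderiv {x₀ y : X} (hy : y ∈ (chartAt H x₀).source) (u : TangentSpace I y) :
    constField I x₀ (mvfderiv I (extChartAt I x₀) y u) y = u := by
  have h := (trivializationAt E (TangentSpace I) x₀).symmL_continuousLinearMapAt (R := ℂ)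
    (b := y) (by simpa using hy) u
  rw [TangentBundle.continuousLinearMapAt_trivializationAt hy] at h
  exact h

theorem mvfderiv_constField {x₀ y : X} (hy : y ∈ (chartAt H x₀).source) (e : E) :
    mvfderiv I (extChartAt I x₀) y (constField I x₀ e y) = e := by
  have h := (trivializationAt E (TangentSpace I) x₀).continuousLinearMapAt_symmL (R := ℂ)
    (b := y) (by simpa using hy) e
  rw [TangentBundle.continuousLinearMapAt_trivializationAt hy] at h
  exact h

/-- The fields `constField I x₀ (b i)` are a frame over the preferred chart around `x₀`. -/
theorem eq_sum_constField {ι : Type*} [Fintype ι] (b : Module.Basis ι ℂ E) {x₀ y : X}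
    (hy : y ∈ (chartAt H x₀).source) (u : TangentSpace I y) :
    u = ∑ i, b.repr (mvfderiv I (extChartAt I x₀) y u) i • constField I x₀ (b i) y := by
  have h : constField I x₀ (∑ i, b.repr (mvfderiv I (extChartAt I x₀) y u) i • b i) y = u := by
    rw [b.sum_repr, constField_mvfderiv hy]
  simp only [constField, map_sum, map_smul] at h ⊢
  exact h.symm

/-- A field is holomorphic if and only if its coordinate vector in the preferred chart is. -/
theorem holomorphicFieldAt_iff {V : Π x : X, TangentSpace I x} {x : X} :
    HolomorphicFieldAt I V x ↔
      ContMDiffAt I 𝓘(ℂ, E) ω (fun y => mvfderiv I (extChartAt I x) y (V y)) x := by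
  unfold HolomorphicFieldAt
  rw [Bundle.contMDiffAt_section]
  refine Filter.EventuallyEq.contMDiffAt_iff ?_
  filter_upwards [chart_source_mem_nhds H x] with y hy
  exact trivializationAt_snd hy _

theorem differentiableFieldAt_iff {V : Π x : X, TangentSpace I x} {x : X} :
    DifferentiableFieldAt I V x ↔
      MDifferentiableAt I 𝓘(ℂ, E) (fun y => mvfderiv I (extChartAt I x) y (V y)) x := by
  unfold DifferentiableFieldAt
  rw [mdifferentiableAt_section]
  refine Filter.EventuallyEq.mdifferentiableAt_iff ?_
  filter_upwards [chart_source_mem_nhds H x] with y hy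
  exact trivializationAt_snd hy _

theorem holomorphicFieldAt_constField (x : X) (e : E) :
    HolomorphicFieldAt I (constField I x e) x := by
  rw [holomorphicFieldAt_iff]
  refine (contMDiffAt_const (c := e)).congr_of_eventuallyEq ?_
  filter_upwards [chart_source_mem_nhds H x] with y hy
  exact mvfderiv_constField hy e

theorem exists_holomorphicField (x : X) (u : TangentSpace I x) :
    ∃ V : Π y : X, TangentSpace I y, HolomorphicFieldAt I V x ∧ V x = u :=
  ⟨_, holomorphicFieldAt_constField x _, constField_mvfderiv (mem_chart_source H x) u⟩

variable [FiniteDimensional ℂ E]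

/-- Holomorphy of `R` is imposed on holomorphic fields only; expanding a field in a coordinate frame
extends it to fields which are merely differentiable at a point. -/
theorem IsHolomorphicEnd.differentiableFieldAt {R : Π x : X, Module.End ℂ (TangentSpace I x)}
    (hR : IsHolomorphicEnd I R) {V : Π x : X, TangentSpace I x} {x : X}
    (hV : DifferentiableFieldAt I V x) : DifferentiableFieldAt I (fun y => R y (V y)) x := by
  have b := Module.finBasis ℂ E
  have hc : ∀ i, MDifferentiableAt I 𝓘(ℂ)
      (fun y => b.repr (mvfderiv I (extChartAt I x) y (V y)) i) x := fun i =>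
    ((b.coord i).toContinuousLinearMap.mdifferentiableAt).comp x (differentiableFieldAt_iff.1 hV)
  have hs : DifferentiableFieldAt I (fun y => ∑ i, b.repr (mvfderiv I (extChartAt I x) y (V y)) i •
      R y (constField I x (b i) y)) x :=
    MDifferentiableAt.sum_section fun i _ => (hc i).smul_section
      (hR x _ (holomorphicFieldAt_constField x (b i))).differentiable
  refine hs.congr_of_eventuallyEq ?_
  filter_upwards [chart_source_mem_nhds H x] with y hy
  congr 1
  conv_lhs => rw [eq_sum_constField b hy (V y)]
  simp

theorem IsHolomorphicBilin.mdifferentiableAt {g : Π x : X, LinearMap.BilinForm ℂ (TangentSpace I x)}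
    (hg : IsHolomorphicBilin I g) {V W : Π x : X, TangentSpace I x} {x : X}
    (hV : DifferentiableFieldAt I V x) (hW : DifferentiableFieldAt I W x) :
    MDifferentiableAt I 𝓘(ℂ) (fun y => g y (V y) (W y)) x := by
  have b := Module.finBasis ℂ E
  have hc : ∀ U : Π x : X, TangentSpace I x, DifferentiableFieldAt I U x →
      ∀ i, MDifferentiableAt I 𝓘(ℂ)
      (fun y => b.repr (mvfderiv I (extChartAt I x) y (U y)) i) x := fun U hU i =>
    ((b.coord i).toContinuousLinearMap.mdifferentiableAt).comp x (differentiableFieldAt_iff.1 hU)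
  have hs : ∀ i j, MDifferentiableAt I 𝓘(ℂ) (fun y =>
      b.repr (mvfderiv I (extChartAt I x) y (V y)) i *
      (b.repr (mvfderiv I (extChartAt I x) y (W y)) j *
        g y (constField I x (b i) y) (constField I x (b j) y))) x := fun i j =>
    (hc V hV i).mul ((hc W hW j).mul ((hg x _ _ (holomorphicFieldAt_constField x (b i))
      (holomorphicFieldAt_constField x (b j))).mdifferentiableAt (by simp)))
  refine (MDifferentiableAt.sum (t := Finset.univ) fun i _ =>
    MDifferentiableAt.sum (t := Finset.univ) fun j _ => hs i j).congr_of_eventuallyEq ?_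
  filter_upwards [chart_source_mem_nhds H x] with y hy
  simp only [Finset.sum_apply]
  conv_lhs => rw [eq_sum_constField b hy (V y), eq_sum_constField b hy (W y)]
  simp only [map_sum, map_smul, LinearMap.sum_apply, LinearMap.smul_apply, smul_eq_mul,
    Finset.mul_sum]
  rw [Finset.sum_comm]
  exact Finset.sum_congr rfl fun i _ => Finset.sum_congr rfl fun j _ => by ring

end Frames

/-! ### The Levi-Civita connection of a holomorphic metric -/

section Koszul
open VectorField
variable {E : Type*} [NormedAddCommGroup E] [NormedSpace ℂ E] [FiniteDimensional ℂ E]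
  {H : Type*} [TopologicalSpace H] {I : ModelWithCorners ℂ E H}
  {X : Type*} [TopologicalSpace X] [ChartedSpace H X] [IsManifold I ω X]
  {g : Π x : X, LinearMap.BilinForm ℂ (TangentSpace I x)}
  {U V W V' W' : Π x : X, TangentSpace I x} {f : X → ℂ} {x : X}

namespace IsHolomorphicBilin

theorem mvfderiv_add_left (hg : IsHolomorphicBilin I g) (hV : DifferentiableFieldAt I V x)
    (hV' : DifferentiableFieldAt I V' x) (hW : DifferentiableFieldAt I W x)
    (u : TangentSpace I x) :
    mvfderiv I (fun y => g y ((V + V') y) (W y)) x u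
      = mvfderiv I (fun y => g y (V y) (W y)) x u + mvfderiv I (fun y => g y (V' y) (W y)) x u := by
  have h : (fun y => g y ((V + V') y) (W y))
    = (fun y => g y (V y) (W y)) + fun y => g y (V' y) (W y) := by
    funext y; simp
  rw [h, mvfderiv_add (hg.mdifferentiableAt hV hW) (hg.mdifferentiableAt hV' hW)]
  rfl

theorem mvfderiv_add_right (hg : IsHolomorphicBilin I g) (hV : DifferentiableFieldAt I V x)
    (hW : DifferentiableFieldAt I W x) (hW' : DifferentiableFieldAt I W' x)
    (u : TangentSpace I x) :
    mvfderiv I (fun y => g y (V y) ((W + W') y)) x u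
      = mvfderiv I (fun y => g y (V y) (W y)) x u + mvfderiv I (fun y => g y (V y) (W' y)) x u := by
  have h : (fun y => g y (V y) ((W + W') y))
    = (fun y => g y (V y) (W y)) + fun y => g y (V y) (W' y) := by
    funext y; simp
  rw [h, mvfderiv_add (hg.mdifferentiableAt hV hW) (hg.mdifferentiableAt hV hW')]
  rfl

theorem mvfderiv_smul_left (hg : IsHolomorphicBilin I g) (hf : MDifferentiableAt I 𝓘(ℂ) f x)
    (hV : DifferentiableFieldAt I V x) (hW : DifferentiableFieldAt I W x) (u : TangentSpace I x) :
    mvfderiv I (fun y => g y ((f • V) y) (W y)) x u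
      = f x * mvfderiv I (fun y => g y (V y) (W y)) x u + mvfderiv I f x u * g x (V x) (W x) := by
  have h : (fun y => g y ((f • V) y) (W y)) = f * fun y => g y (V y) (W y) := by
    funext y; simp
  rw [h, mvfderiv_mul hf (hg.mdifferentiableAt hV hW)]
  simp [mul_comm]

theorem mvfderiv_smul_right (hg : IsHolomorphicBilin I g) (hf : MDifferentiableAt I 𝓘(ℂ) f x)
    (hV : DifferentiableFieldAt I V x) (hW : DifferentiableFieldAt I W x) (u : TangentSpace I x) :
    mvfderiv I (fun y => g y (V y) ((f • W) y)) x u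
      = f x * mvfderiv I (fun y => g y (V y) (W y)) x u + mvfderiv I f x u * g x (V x) (W x) := by
  have h : (fun y => g y (V y) ((f • W) y)) = f * fun y => g y (V y) (W y) := by
    funext y; simp
  rw [h, mvfderiv_mul hf (hg.mdifferentiableAt hV hW)]
  simp [mul_comm]

end IsHolomorphicBilin

variable (g) in
/-- The right-hand side of the Koszul formula, which equals `2 g (∇_U V, W)` at `x` for the
Levi-Civita connection of `g`. -/
def koszul (U V W : Π x : X, TangentSpace I x) (x : X) : ℂ :=
  mvfderiv I (fun y => g y (V y) (W y)) x (U x) + mvfderiv I (fun y => g y (U y) (W y)) x (V x)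
    - mvfderiv I (fun y => g y (U y) (V y)) x (W x) + g x (mlieBracket I U V x) (W x)
    - g x (mlieBracket I U W x) (V x) - g x (mlieBracket I V W x) (U x)

omit [FiniteDimensional ℂ E] in
theorem IsHolomorphicMetric.ext_left (hg : IsHolomorphicMetric I g) {v v' : TangentSpace I x}
    (h : ∀ w, g x v w = g x v' w) : v = v' := by
  rw [← sub_eq_zero]
  exact hg.nondegenerate x _ fun w => by simp [h]

/-- The Koszul formula. -/
theorem IsLeviCivita.koszul_eq (hg : IsHolomorphicMetric I g)
    {cov : CovariantDerivative I E (TangentSpace I : X → Type _)} (hcov : IsLeviCivita I g cov)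
    (hU : DifferentiableFieldAt I U x) (hV : DifferentiableFieldAt I V x)
    (hW : DifferentiableFieldAt I W x) :
    koszul g U V W x = 2 * g x (cov V x (U x)) (W x) := by
  have : CompleteSpace E := FiniteDimensional.complete ℂ E
  have ht {X₁ X₂ : Π x : X, TangentSpace I x} (h₁ : DifferentiableFieldAt I X₁ x)
      (h₂ : DifferentiableFieldAt I X₂ x) :
      cov X₂ x (X₁ x) - cov X₁ x (X₂ x) = mlieBracket I X₁ X₂ x :=
    cov.torsion_eq_zero_iff.1 hcov.torsion_free h₁ h₂
  rw [koszul, hcov.metric x V W hV hW, hcov.metric x U W hU hW, hcov.metric x U V hU hV,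
    ← ht hU hV, ← ht hU hW, ← ht hV hW]
  simp only [map_sub, LinearMap.sub_apply]
  rw [hg.symmetric x (cov U x (W x)) (V x), hg.symmetric x (cov W x (U x)) (V x),
    hg.symmetric x (cov W x (V x)) (U x), hg.symmetric x (cov V x (W x)) (U x)]
  ring

section
variable (hg : IsHolomorphicMetric I g) (hf : MDifferentiableAt I 𝓘(ℂ) f x)
  (hU : DifferentiableFieldAt I U x) (hV : DifferentiableFieldAt I V x)
  (hV' : DifferentiableFieldAt I V' x) (hW : DifferentiableFieldAt I W x)
include hg hU hV hW

include hV' in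
theorem koszul_add_mid : koszul g U (V + V') W x = koszul g U V W x + koszul g U V' W x := by
  have : CompleteSpace E := FiniteDimensional.complete ℂ E
  simp only [koszul]
  rw [hg.holomorphic.mvfderiv_add_left hV hV' hW, hg.holomorphic.mvfderiv_add_right hU hV hV',
    mlieBracket_add_right hV hV', mlieBracket_add_left hV hV']
  simp only [map_add, LinearMap.add_apply, Pi.add_apply]
  ring

include hf in
theorem koszul_smul_mid : koszul g U (f • V) W x
    = f x * koszul g U V W x + 2 * (mvfderiv I f x (U x) * g x (V x) (W x)) := by
  have : CompleteSpace E := FiniteDimensional.complete ℂ E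
  simp only [koszul]
  rw [hg.holomorphic.mvfderiv_smul_left hf hV hW, hg.holomorphic.mvfderiv_smul_right hf hU hV,
    mlieBracket_smul_right hf hV, mlieBracket_smul_left hf hV]
  simp only [map_add, LinearMap.add_apply, Pi.smul_apply', map_smul, LinearMap.smul_apply,
    smul_eq_mul, neg_smul, map_neg, LinearMap.neg_apply]
  rw [hg.symmetric x (V x) (U x)]
  ring

include hV' in
theorem koszul_add_right : koszul g U W (V + V') x = koszul g U W V x + koszul g U W V' x := by
  have : CompleteSpace E := FiniteDimensional.complete ℂ E
  simp only [koszul]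
  rw [hg.holomorphic.mvfderiv_add_right hW hV hV', hg.holomorphic.mvfderiv_add_right hU hV hV',
    mlieBracket_add_right hV hV', mlieBracket_add_right hV hV']
  simp only [map_add, LinearMap.add_apply, Pi.add_apply]
  ring

include hf in
theorem koszul_smul_right : koszul g U W (f • V) x = f x * koszul g U W V x := by
  have : CompleteSpace E := FiniteDimensional.complete ℂ E
  simp only [koszul]
  rw [hg.holomorphic.mvfderiv_smul_right hf hW hV, hg.holomorphic.mvfderiv_smul_right hf hU hV,
    mlieBracket_smul_right hf hV, mlieBracket_smul_right hf hV]
  simp only [map_add, LinearMap.add_apply, Pi.smul_apply', map_smul, LinearMap.smul_apply,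
    smul_eq_mul]
  rw [hg.symmetric x (V x) (U x), hg.symmetric x (V x) (W x)]
  ring

omit [FiniteDimensional ℂ E] hU hV hW in
/-- The expression behind `∇ g = 0`. -/
theorem koszul_add_koszul_swap : koszul g U V W x + koszul g U W V x =
    2 * mvfderiv I (fun y => g y (V y) (W y)) x (U x) := by
  have h : (fun y => g y (W y) (V y)) = fun y => g y (V y) (W y) :=
    funext fun y => hg.symmetric y _ _
  simp only [koszul, h]
  rw [mlieBracket_swap_apply (V := W) (W := V)]
  simp only [map_neg, LinearMap.neg_apply]
  ring

omit [FiniteDimensional ℂ E] hU hV hW in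
/-- The expression behind the vanishing of the torsion; it also reduces the behaviour of `koszul` in
its first argument to that in its second. -/
theorem koszul_swap : koszul g U V W x = koszul g V U W x + 2 * g x (mlieBracket I U V x) (W x) := by
  have h : (fun y => g y (U y) (V y)) = fun y => g y (V y) (U y) :=
    funext fun y => hg.symmetric y _ _
  simp only [koszul, h]
  rw [mlieBracket_swap_apply (V := V) (W := U)]
  simp only [map_neg, LinearMap.neg_apply]
  ring

include hV' in
theorem koszul_add_left : koszul g (V + V') U W x = koszul g V U W x + koszul g V' U W x := by
  have : CompleteSpace E := FiniteDimensional.complete ℂ E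
  rw [koszul_swap hg, koszul_add_mid hg hU hV hV' hW, koszul_swap hg (U := V) (V := U),
    koszul_swap hg (U := V') (V := U), mlieBracket_add_left hV hV']
  simp only [map_add, LinearMap.add_apply]
  ring

include hf in
theorem koszul_smul_left : koszul g (f • V) U W x = f x * koszul g V U W x := by
  have : CompleteSpace E := FiniteDimensional.complete ℂ E
  rw [koszul_swap hg, koszul_smul_mid hg hf hU hV hW, koszul_swap hg (U := V) (V := U),
    mlieBracket_smul_left hf hV]
  simp only [map_add, LinearMap.add_apply, map_smul, LinearMap.smul_apply, smul_eq_mul, neg_smul,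
    map_neg, LinearMap.neg_apply]
  ring

omit hU hW in
/-- As the Koszul expression is tensorial in `U` and `W` and `g` is non-degenerate, it is
represented by an endomorphism of the tangent space, the covariant derivative of `V`. -/
theorem exists_koszul_representative :
    ∃ L : TangentSpace I x →L[ℂ] TangentSpace I x, ∀ U W : Π x : X, TangentSpace I x,
      DifferentiableFieldAt I U x → DifferentiableFieldAt I W x →
        2 * g x (L (U x)) (W x) = koszul g U V W x := by
  have h₁ : ∀ W, DifferentiableFieldAt I W x → TensorialAt I E (fun U => koszul g U V W x) x :=
    fun W hW => ⟨fun hf hU => koszul_smul_left hg hf hV hU hW,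
      fun hU hU' => koszul_add_left hg hV hU hU' hW⟩
  have h₂ : ∀ U, DifferentiableFieldAt I U x → TensorialAt I E (fun W => koszul g U V W x) x :=
    fun U hU => ⟨fun hf hW => koszul_smul_right hg hf hU hW hV,
      fun hW hW' => koszul_add_right hg hU hW hW' hV⟩
  have : FiniteDimensional ℂ (TangentSpace I x) := inferInstanceAs (FiniteDimensional ℂ E)
  have : T2Space (TangentSpace I x) := inferInstanceAs (T2Space E)
  set B := TensorialAt.mkHom₂ (fun U W => koszul g U V W x) x h₁ h₂ with hB
  have hn : (g x).Nondegenerate := ⟨hg.nondegenerate x, fun w hw =>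
    hg.nondegenerate x w fun v => (hg.symmetric x w v).trans (hw v)⟩
  let L : TangentSpace I x →ₗ[ℂ] TangentSpace I x :=
    ((1 / 2 : ℂ) • ((g x).toDual hn).symm.toLinearMap) ∘ₗ
      (ContinuousLinearMap.coeLM ℂ ∘ₗ B.toLinearMap)
  refine ⟨L.toContinuousLinearMap, fun U W hU hW => ?_⟩
  rw [← TensorialAt.mkHom₂_apply h₁ h₂ hU hW, ← hB]
  simp [L]

end

/-- Every holomorphic metric has a Levi-Civita connection. No regularity is asked of a
`CovariantDerivative`, so the covariant derivative of a field may be prescribed by the Koszul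
formula at the points where the field is differentiable, and arbitrarily elsewhere. -/
theorem IsHolomorphicMetric.exists_isLeviCivita (hg : IsHolomorphicMetric I g) :
    ∃ cov : CovariantDerivative I E (TangentSpace I : X → Type _), IsLeviCivita I g cov := by
  have : CompleteSpace E := FiniteDimensional.complete ℂ E
  have hL : ∀ (V : Π x : X, TangentSpace I x) (x : X),
    ∃ L : TangentSpace I x →L[ℂ] TangentSpace I x, DifferentiableFieldAt I V x →
      ∀ U W : Π x : X, TangentSpace I x,
      DifferentiableFieldAt I U x → DifferentiableFieldAt I W x →
        2 * g x (L (U x)) (W x) = koszul g U V W x := by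
    intro V x
    by_cases hV : DifferentiableFieldAt I V x
    · obtain ⟨L, hL⟩ := exists_koszul_representative hg hV
      exact ⟨L, fun _ => hL⟩
    · exact ⟨0, fun h => absurd h hV⟩
  choose L hL using hL
  have hext : ∀ {x : X} {A B : TangentSpace I x →L[ℂ] TangentSpace I x},
      (∀ U W : Π x : X, TangentSpace I x, DifferentiableFieldAt I U x → DifferentiableFieldAt I W x →
        2 * g x (A (U x)) (W x) = 2 * g x (B (U x)) (W x)) → A = B := by
    intro x A B h
    ext u
    refine hg.ext_left fun w => ?_
    obtain ⟨U, hU, rfl⟩ := exists_holomorphicField (I := I) x u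
    obtain ⟨W, hW, rfl⟩ := exists_holomorphicField (I := I) x w
    exact mul_left_cancel₀ two_ne_zero (h U W hU.differentiable hW.differentiable)
  let cov : CovariantDerivative I E (TangentSpace I : X → Type _) :=
    { toFun := L
      isCovariantDerivativeOnUniv :=
        { add := fun {V V' x} hV hV' _ => hext fun U W hU hW => by
            rw [hL _ _ (mdifferentiableAt_add_section hV hV') U W hU hW,
              koszul_add_mid hg hU hV hV' hW, ← hL V x hV U W hU hW, ← hL V' x hV' U W hU hW]
            simp [mul_add]
          leibniz := fun {V f x} hV hf _ => hext fun U W hU hW => by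
            rw [hL _ _ (hf.smul_section hV) U W hU hW, koszul_smul_mid hg hf hU hV hW,
              ← hL V x hV U W hU hW]
            simp
            ring } }
  refine ⟨cov, cov.torsion_eq_zero_iff.2 fun {U V x} hU hV => hg.ext_left fun w => ?_,
    fun x V W hV hW u => ?_⟩
  · obtain ⟨W, hW, rfl⟩ := exists_holomorphicField (I := I) x w
    have h₁ := hL V x hV U W hU hW.differentiable
    have h₂ := hL U x hU V W hV hW.differentiable
    have h₃ := koszul_swap hg (U := U) (V := V) (W := W) (x := x)
    simp only [map_sub, LinearMap.sub_apply]
    change g x (L V x (U x)) (W x) - g x (L U x (V x)) (W x) = _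
    linear_combination (1 / 2 : ℂ) * (h₁ - h₂ + h₃)
  · obtain ⟨U, hU, rfl⟩ := exists_holomorphicField (I := I) x u
    have h₁ := hL V x hV U W hU.differentiable hW
    have h₂ := hL W x hW U V hU.differentiable hV
    have h₃ := koszul_add_koszul_swap hg (U := U) (V := V) (W := W) (x := x)
    rw [hg.symmetric x (V x)]
    change _ = g x (L V x (U x)) (W x) + g x (L W x (U x)) (V x)
    linear_combination - (1 / 2 : ℂ) * (h₁ + h₂ + h₃)

end Koszul

/-! ### Sections of `π^* T_M` -/

section TotalSpace
variable {E : Type*} [NormedAddCommGroup E] [NormedSpace ℂ E]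
  {M : Type*} [TopologicalSpace M] [ChartedSpace E M] [IsManifold 𝓘(ℂ, E) ω M]

theorem eventually_proj_mem_source (x : TangentBundle 𝓘(ℂ, E) M) :
    ∀ᶠ y : TangentBundle 𝓘(ℂ, E) M in 𝓝 x, y.proj ∈ (chartAt E x.proj).source :=
  (FiberBundle.continuous_proj E _).continuousAt.preimage_mem_nhds (chart_source_mem_nhds _ _)

theorem mvfderiv_extChartAt_projDeriv {x y : TangentBundle 𝓘(ℂ, E) M}
    (hy : y.proj ∈ (chartAt E x.proj).source) (w : TangentSpace 𝓘(ℂ, E).tangent y) :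
    mvfderiv 𝓘(ℂ, E) (extChartAt 𝓘(ℂ, E) x.proj) y.proj (projDeriv y w)
      = (mvfderiv 𝓘(ℂ, E).tangent (extChartAt 𝓘(ℂ, E).tangent x) y w).1 := by
  have hπ : MDifferentiableAt 𝓘(ℂ, E).tangent 𝓘(ℂ, E)
      (Bundle.TotalSpace.proj : TangentBundle 𝓘(ℂ, E) M → M) y :=
    (Bundle.contMDiffAt_proj (TangentSpace 𝓘(ℂ, E)) (n := ω)).mdifferentiableAt (by simp)
  have h1 : MDifferentiableAt 𝓘(ℂ, E) 𝓘(ℂ, E) (extChartAt 𝓘(ℂ, E) x.proj) y.proj :=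
    mdifferentiableAt_extChartAt hy
  have h2 : MDifferentiableAt 𝓘(ℂ, E).tangent 𝓘(ℂ, E × E) (extChartAt 𝓘(ℂ, E).tangent x) y :=
    mdifferentiableAt_extChartAt (by simpa using hy)
  have h3 : MDifferentiableAt 𝓘(ℂ, E × E) 𝓘(ℂ, E) (Prod.fst : E × E → E)
    (extChartAt 𝓘(ℂ, E).tangent x y) := differentiableAt_fst.mdifferentiableAt
  have h : extChartAt 𝓘(ℂ, E) x.proj ∘ (Bundle.TotalSpace.proj : TangentBundle 𝓘(ℂ, E) M → M)
      = Prod.fst ∘ extChartAt 𝓘(ℂ, E).tangent x := by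
    funext z
    rw [Function.comp_apply, Function.comp_apply, FiberBundle.extChartAt]
    rfl
  refine (mfderiv_comp_apply y h1 hπ w).symm.trans ?_
  rw [h]
  refine (mfderiv_comp_apply y h3 h2 w).trans ?_
  rw [mfderiv_eq_fderiv, fderiv_fst]
  rfl

theorem mvfderiv_extChartAt_vert {x y : TangentBundle 𝓘(ℂ, E) M}
    (hy : y.proj ∈ (chartAt E x.proj).source) (u : TangentSpace 𝓘(ℂ, E) y.proj) :
    mvfderiv 𝓘(ℂ, E).tangent (extChartAt 𝓘(ℂ, E).tangent x) y (vert y u)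
      = (0, mvfderiv 𝓘(ℂ, E) (extChartAt 𝓘(ℂ, E) x.proj) y.proj u) := by
  refine (extChartAt_vert x y hy u).trans ?_
  rw [coordAt, TangentBundle.continuousLinearMapAt_trivializationAt hy]
  rfl

/-- The section `p` of `π^* T_M` over `X = T_M` is holomorphic near `x`, which is tested in the
preferred chart of `M` around `π x`. -/
def HolomorphicAlongAt (p : Π y : TangentBundle 𝓘(ℂ, E) M, TangentSpace 𝓘(ℂ, E) y.proj)
    (x : TangentBundle 𝓘(ℂ, E) M) : Prop :=
  ContMDiffAt 𝓘(ℂ, E).tangent 𝓘(ℂ, E) ω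
    (fun y => mvfderiv 𝓘(ℂ, E) (extChartAt 𝓘(ℂ, E) x.proj) y.proj (p y)) x

/-- In the preferred charts of `X` and `M`, the map `π_*` is the projection `E × E → E` to the first
factor. -/
theorem HolomorphicFieldAt.projDeriv {V : Π x : TangentBundle 𝓘(ℂ, E) M,
    TangentSpace 𝓘(ℂ, E).tangent x} {x : TangentBundle 𝓘(ℂ, E) M}
    (hV : HolomorphicFieldAt 𝓘(ℂ, E).tangent V x) :
    HolomorphicAlongAt (fun y => projDeriv y (V y)) x := by
  refine ((contDiff_fst.contMDiff.contMDiffAt).comp x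
    (holomorphicFieldAt_iff.1 hV)).congr_of_eventuallyEq ?_
  filter_upwards [eventually_proj_mem_source x] with y hy
  exact mvfderiv_extChartAt_projDeriv hy _

/-- Let `L` be a field of linear maps `T_{M, π x} → T_{X, x}`. If `L` takes vector fields pulled back
from `M` to holomorphic ones, then it takes every holomorphic section of `π^* T_M` to a holomorphic
field, since the pulled back fields generate `π^* T_M`. -/
theorem HolomorphicAlongAt.lift [FiniteDimensional ℂ E]
    {L : Π x : TangentBundle 𝓘(ℂ, E) M,
      TangentSpace 𝓘(ℂ, E) x.proj →ₗ[ℂ] TangentSpace 𝓘(ℂ, E).tangent x}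
    (hL : ∀ (x : TangentBundle 𝓘(ℂ, E) M) (u : Π m : M, TangentSpace 𝓘(ℂ, E) m),
      HolomorphicFieldAt 𝓘(ℂ, E) u x.proj →
        HolomorphicFieldAt 𝓘(ℂ, E).tangent (fun y => L y (u y.proj)) x)
    {p : Π y : TangentBundle 𝓘(ℂ, E) M, TangentSpace 𝓘(ℂ, E) y.proj}
    {x : TangentBundle 𝓘(ℂ, E) M} (hp : HolomorphicAlongAt p x) :
    HolomorphicFieldAt 𝓘(ℂ, E).tangent (fun y => L y (p y)) x := by
  have b := Module.finBasis ℂ E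
  have hc : ∀ i, ContMDiffAt 𝓘(ℂ, E).tangent 𝓘(ℂ) ω (fun y =>
      b.repr (mvfderiv 𝓘(ℂ, E) (extChartAt 𝓘(ℂ, E) x.proj) y.proj (p y)) i) x := fun i =>
    ((b.coord i).toContinuousLinearMap.contMDiff.contMDiffAt).comp x hp
  have hs : HolomorphicFieldAt 𝓘(ℂ, E).tangent (fun y => ∑ i,
      b.repr (mvfderiv 𝓘(ℂ, E) (extChartAt 𝓘(ℂ, E) x.proj) y.proj (p y)) i •
      L y (constField 𝓘(ℂ, E) x.proj (b i) y.proj)) x :=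
    ContMDiffAt.sum_section fun i _ => (hc i).smul_section
      (hL x _ (holomorphicFieldAt_constField x.proj (b i)))
  refine hs.congr_of_eventuallyEq ?_
  filter_upwards [eventually_proj_mem_source x] with y hy
  congr 1
  conv_lhs => rw [eq_sum_constField b hy (p y)]
  simp

theorem contMDiffAt_bilin_along [FiniteDimensional ℂ E]
    {σ : Π m : M, LinearMap.BilinForm ℂ (TangentSpace 𝓘(ℂ, E) m)}
    (hσ : IsHolomorphicBilin 𝓘(ℂ, E) σ)
    {p q : Π y : TangentBundle 𝓘(ℂ, E) M, TangentSpace 𝓘(ℂ, E) y.proj}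
    {x : TangentBundle 𝓘(ℂ, E) M} (hp : HolomorphicAlongAt p x) (hq : HolomorphicAlongAt q x) :
    ContMDiffAt 𝓘(ℂ, E).tangent 𝓘(ℂ) ω (fun y => σ y.proj (p y) (q y)) x := by
  have b := Module.finBasis ℂ E
  have hc : ∀ {p : Π y : TangentBundle 𝓘(ℂ, E) M, TangentSpace 𝓘(ℂ, E) y.proj},
      HolomorphicAlongAt p x → ∀ i, ContMDiffAt 𝓘(ℂ, E).tangent 𝓘(ℂ) ω (fun y =>
      b.repr (mvfderiv 𝓘(ℂ, E) (extChartAt 𝓘(ℂ, E) x.proj) y.proj (p y)) i) x := fun hp i =>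
    ((b.coord i).toContinuousLinearMap.contMDiff.contMDiffAt).comp x hp
  have hs : ∀ i j, ContMDiffAt 𝓘(ℂ, E).tangent 𝓘(ℂ) ω (fun y =>
      b.repr (mvfderiv 𝓘(ℂ, E) (extChartAt 𝓘(ℂ, E) x.proj) y.proj (p y)) i *
      (b.repr (mvfderiv 𝓘(ℂ, E) (extChartAt 𝓘(ℂ, E) x.proj) y.proj (q y)) j *
        σ y.proj (constField 𝓘(ℂ, E) x.proj (b i) y.proj)
          (constField 𝓘(ℂ, E) x.proj (b j) y.proj))) x := fun i j =>
    (hc hp i).mul ((hc hq j).mul ((hσ x.proj _ _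
      (holomorphicFieldAt_constField x.proj (b i))
      (holomorphicFieldAt_constField x.proj (b j))).comp x
        (Bundle.contMDiffAt_proj (TangentSpace 𝓘(ℂ, E)))))
  refine (contMDiffAt_finsetSum (t := Finset.univ) fun i _ =>
    contMDiffAt_finsetSum (t := Finset.univ) fun j _ => hs i j).congr_of_eventuallyEq ?_
  filter_upwards [eventually_proj_mem_source x] with y hy
  conv_lhs => rw [eq_sum_constField b hy (p y), eq_sum_constField b hy (q y)]
  simp only [map_sum, map_smul, LinearMap.sum_apply, LinearMap.smul_apply, smul_eq_mul,
    Finset.mul_sum]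
  rw [Finset.sum_comm]
  exact Finset.sum_congr rfl fun i _ => Finset.sum_congr rfl fun j _ => by ring

end TotalSpace

/-! ### The splitting of `T_X`, the metric and the operators -/

section Operators
variable {E : Type*} [NormedAddCommGroup E] [NormedSpace ℂ E] [FiniteDimensional ℂ E]
  {M : Type*} [TopologicalSpace M] [ChartedSpace E M] [IsManifold 𝓘(ℂ, E) ω M]

namespace NonlinearConnection
variable (h : NonlinearConnection E M) {x : TangentBundle 𝓘(ℂ, E) M}
  {V W : Π x : TangentBundle 𝓘(ℂ, E) M, TangentSpace 𝓘(ℂ, E).tangent x}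
  {σ : Π m : M, LinearMap.BilinForm ℂ (TangentSpace 𝓘(ℂ, E) m)}

theorem lift_add_vert (w : TangentSpace 𝓘(ℂ, E).tangent x) :
    h.lift x (h.hPart x w) + vert x (h.vPart x w) = w := by
  rw [← h.split_apply]
  exact (h.split x).apply_symm_apply w

theorem hPart_eq_projDeriv (x : TangentBundle 𝓘(ℂ, E) M) : h.hPart x = projDeriv x := by
  ext w
  have := congrArg (projDeriv x) (h.lift_add_vert w)
  rwa [map_add, h.proj_lift, projDeriv_vert, add_zero] at this

theorem holomorphicAlongAt_hPart (hV : HolomorphicFieldAt 𝓘(ℂ, E).tangent V x) :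
    HolomorphicAlongAt (fun y => h.hPart y (V y)) x := by
  simp only [hPart_eq_projDeriv]
  exact hV.projDeriv

theorem holomorphicFieldAt_lift {p : Π y : TangentBundle 𝓘(ℂ, E) M, TangentSpace 𝓘(ℂ, E) y.proj}
    (hp : HolomorphicAlongAt p x) :
    HolomorphicFieldAt 𝓘(ℂ, E).tangent (fun y => h.lift y (p y)) x :=
  hp.lift h.holomorphic

omit h in
theorem _root_.PreJoyce.HolomorphicAlongAt.vert
    {p : Π y : TangentBundle 𝓘(ℂ, E) M, TangentSpace 𝓘(ℂ, E) y.proj}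
    (hp : HolomorphicAlongAt p x) :
    HolomorphicFieldAt 𝓘(ℂ, E).tangent (fun y => vert y (p y)) x :=
  hp.lift fun _ _ => holomorphicFieldAt_vert

/-- The vertical part of `V` is `V - h (π_* V)`, and `v` is the inclusion of the second factor of
`E × E` in the preferred charts. -/
theorem holomorphicAlongAt_vPart (hV : HolomorphicFieldAt 𝓘(ℂ, E).tangent V x) :
    HolomorphicAlongAt (fun y => h.vPart y (V y)) x := by
  have h1 : HolomorphicFieldAt 𝓘(ℂ, E).tangent (fun y => V y - h.lift y (h.hPart y (V y))) x :=
    ContMDiffAt.sub_section hV (h.holomorphicFieldAt_lift (h.holomorphicAlongAt_hPart hV))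
  refine ((contDiff_snd.contMDiff.contMDiffAt).comp x
    (holomorphicFieldAt_iff.1 h1)).congr_of_eventuallyEq ?_
  filter_upwards [eventually_proj_mem_source x] with y hy
  have h2 : V y - h.lift y (h.hPart y (V y)) = vert y (h.vPart y (V y)) :=
    sub_eq_of_eq_add' (h.lift_add_vert (V y)).symm
  rw [Function.comp_apply, h2, mvfderiv_extChartAt_vert hy]

/-- The projection of `T_X` to the horizontal sub-bundle, along the vertical one. -/
def horProj (x : TangentBundle 𝓘(ℂ, E) M) : Module.End ℂ (TangentSpace 𝓘(ℂ, E).tangent x) :=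
  h.lift x ∘ₗ projDeriv x

/-- The projection of `T_X` to the vertical sub-bundle, along the horizontal one. -/
def vertProj (x : TangentBundle 𝓘(ℂ, E) M) : Module.End ℂ (TangentSpace 𝓘(ℂ, E).tangent x) :=
  vert x ∘ₗ h.vPart x

theorem isHolomorphicEnd_horProj : IsHolomorphicEnd 𝓘(ℂ, E).tangent h.horProj := fun _ _ hV =>
  h.holomorphicFieldAt_lift hV.projDeriv

theorem isHolomorphicEnd_vertProj : IsHolomorphicEnd 𝓘(ℂ, E).tangent h.vertProj := fun _ _ hV =>
  (h.holomorphicAlongAt_vPart hV).vert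

theorem isHolomorphicEnd_opI : IsHolomorphicEnd 𝓘(ℂ, E).tangent h.opI := fun _ _ hV =>
  ContMDiffAt.sub_section
    ((h.holomorphicFieldAt_lift (h.holomorphicAlongAt_hPart hV)).const_smul_section (a := Complex.I))
    ((h.holomorphicAlongAt_vPart hV).vert.const_smul_section (a := Complex.I))

theorem isHolomorphicEnd_opJ : IsHolomorphicEnd 𝓘(ℂ, E).tangent h.opJ := fun _ _ hV =>
  ContMDiffAt.add_section (ContMDiffAt.neg_section (h.holomorphicAlongAt_hPart hV).vert)
    (h.holomorphicFieldAt_lift (h.holomorphicAlongAt_vPart hV))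

theorem isHolomorphicEnd_opK : IsHolomorphicEnd 𝓘(ℂ, E).tangent h.opK := fun _ _ hV =>
  ContMDiffAt.add_section
    ((h.holomorphicAlongAt_hPart hV).vert.const_smul_section (a := Complex.I))
    ((h.holomorphicFieldAt_lift (h.holomorphicAlongAt_vPart hV)).const_smul_section
      (a := Complex.I))

theorem isHolomorphicMetric_metric (hσ : IsHolomorphicSymplectic 𝓘(ℂ, E) σ) :
    IsHolomorphicMetric 𝓘(ℂ, E).tangent (h.metric σ) where
  holomorphic x V W hV hW := by
    have h1 := contMDiffAt_bilin_along hσ.holomorphic (h.holomorphicAlongAt_hPart hV)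
      (h.holomorphicAlongAt_vPart hW)
    have h2 := contMDiffAt_bilin_along hσ.holomorphic (h.holomorphicAlongAt_hPart hW)
      (h.holomorphicAlongAt_vPart hV)
    exact (contMDiffAt_const (c := (1 / 2 : ℂ))).mul (h1.add h2)
  symmetric x u u' := by
    simp [metric, add_comm]
  nondegenerate x u hu := by
    have hv : h.vPart x u = 0 := hσ.nondegenerate _ _ fun a => by
      have h1 := hu (h.lift x a)
      rw [← h.lift_add_vert u, map_add, LinearMap.add_apply, metric_lift_lift,
        metric_vert_lift] at h1
      have h2 : σ x.proj a (h.vPart x u) = 0 := by simpa using h1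
      exact (LinearMap.IsAlt.neg (fun v => hσ.alternating _ v) _ _).symm.trans (by simp [h2])
    have hh : h.hPart x u = 0 := hσ.nondegenerate _ _ fun a => by
      have h1 := hu (vert x a)
      rw [← h.lift_add_vert u, map_add, LinearMap.add_apply, metric_lift_vert,
        metric_vert_vert] at h1
      simpa using h1
    rw [← h.lift_add_vert u, hv, hh, map_zero, map_zero, add_zero]

section Algebra
variable (x)

theorem end_ext {A B : Module.End ℂ (TangentSpace 𝓘(ℂ, E).tangent x)}
    (h₁ : ∀ a, A (h.lift x a) = B (h.lift x a)) (h₂ : ∀ a, A (vert x a) = B (vert x a)) :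
    A = B := by
  ext w
  rw [← h.lift_add_vert w, map_add, map_add, h₁, h₂]

theorem opI_mul_opI : h.opI x * h.opI x = -1 := by
  refine h.end_ext x (fun a => ?_) fun a => ?_ <;>
    simp [opI_lift, opI_vert, smul_smul]

theorem opJ_mul_opJ : h.opJ x * h.opJ x = -1 := by
  refine h.end_ext x (fun a => ?_) fun a => ?_ <;>
    simp [opJ_lift, opJ_vert]

theorem opK_mul_opK : h.opK x * h.opK x = -1 := by
  refine h.end_ext x (fun a => ?_) fun a => ?_ <;>
    simp [opK_lift, opK_vert, smul_smul]

theorem opI_mul_opJ_mul_opK : h.opI x * h.opJ x * h.opK x = -1 := by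
  refine h.end_ext x (fun a => ?_) fun a => ?_ <;>
    simp [opI_lift, opI_vert, opJ_lift, opJ_vert, opK_lift, opK_vert, smul_smul]

theorem metric_opI (u u' : TangentSpace 𝓘(ℂ, E).tangent x) :
    h.metric σ x (h.opI x u) (h.opI x u') = h.metric σ x u u' := by
  rw [← h.lift_add_vert u, ← h.lift_add_vert u']
  simp only [map_add, LinearMap.add_apply, opI_lift, opI_vert, map_smul, map_neg,
    LinearMap.smul_apply, LinearMap.neg_apply, metric_lift_lift, metric_vert_vert,
    metric_lift_vert, metric_vert_lift, smul_eq_mul]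
  linear_combination (-(1 / 2 : ℂ) * σ x.proj (h.hPart x u) (h.vPart x u')
    - (1 / 2 : ℂ) * σ x.proj (h.hPart x u') (h.vPart x u)) * Complex.I_mul_I

variable (hσ : ∀ (m : M) (u : TangentSpace 𝓘(ℂ, E) m), σ m u u = 0)
include hσ

theorem metric_opJ (u u' : TangentSpace 𝓘(ℂ, E).tangent x) :
    h.metric σ x (h.opJ x u) (h.opJ x u') = h.metric σ x u u' := by
  have hs : ∀ a b, σ x.proj a b = -σ x.proj b a := fun a b =>
    (LinearMap.IsAlt.neg (hσ x.proj) b a).symm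
  rw [← h.lift_add_vert u, ← h.lift_add_vert u']
  simp only [map_add, LinearMap.add_apply, opJ_lift, opJ_vert, map_neg,
    LinearMap.neg_apply, metric_lift_lift, metric_vert_vert,
    metric_lift_vert, metric_vert_lift]
  rw [hs (h.vPart x u), hs (h.vPart x u')]
  ring

theorem metric_opK (u u' : TangentSpace 𝓘(ℂ, E).tangent x) :
    h.metric σ x (h.opK x u) (h.opK x u') = h.metric σ x u u' := by
  have hs : ∀ a b, σ x.proj a b = -σ x.proj b a := fun a b =>
    (LinearMap.IsAlt.neg (hσ x.proj) b a).symm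
  rw [← h.lift_add_vert u, ← h.lift_add_vert u']
  simp only [map_add, LinearMap.add_apply, opK_lift, opK_vert, map_smul,
    LinearMap.smul_apply, metric_lift_lift, metric_vert_vert,
    metric_lift_vert, metric_vert_lift, smul_eq_mul]
  rw [hs (h.vPart x u), hs (h.vPart x u')]
  linear_combination (-(1 / 2 : ℂ) * σ x.proj (h.hPart x u) (h.vPart x u')
    - (1 / 2 : ℂ) * σ x.proj (h.hPart x u') (h.vPart x u)) * Complex.I_mul_I

end Algebra
end NonlinearConnection
end Operators

/-! ### Brackets of horizontal and vertical lifts -/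

section LiftBrackets
open VectorField
variable {E : Type*} [NormedAddCommGroup E] [NormedSpace ℂ E] [FiniteDimensional ℂ E]
  {M : Type*} [TopologicalSpace M] [ChartedSpace E M] [IsManifold 𝓘(ℂ, E) ω M]
  {x : TangentBundle 𝓘(ℂ, E) M}
  {V W : Π x : TangentBundle 𝓘(ℂ, E) M, TangentSpace 𝓘(ℂ, E).tangent x}
  {a b c : Π m : M, TangentSpace 𝓘(ℂ, E) m}

theorem projDeriv_mlieBracket (hV : DifferentiableFieldAt 𝓘(ℂ, E).tangent V x)
    (hW : DifferentiableFieldAt 𝓘(ℂ, E).tangent W x)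
    (ha : DifferentiableFieldAt 𝓘(ℂ, E) a x.proj) (hb : DifferentiableFieldAt 𝓘(ℂ, E) b x.proj)
    (hVa : ∀ᶠ y in 𝓝 x, projDeriv y (V y) = a y.proj)
    (hWb : ∀ᶠ y in 𝓝 x, projDeriv y (W y) = b y.proj) :
    projDeriv x (mlieBracket 𝓘(ℂ, E).tangent V W x) = mlieBracket 𝓘(ℂ, E) a b x.proj := by
  have : CompleteSpace E := FiniteDimensional.complete ℂ E
  exact mfderiv_mlieBracket_of_related (Bundle.contMDiffAt_proj (TangentSpace 𝓘(ℂ, E)))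
    hV hW ha hb hVa hWb

omit [FiniteDimensional ℂ E] in
theorem mlieBracket_model_space (V W : Π z : E, TangentSpace 𝓘(ℂ, E) z) (z : E) :
    mlieBracket 𝓘(ℂ, E) V W z = lieBracket ℂ V W z := by
  rw [← mlieBracketWithin_univ, mlieBracketWithin_eq_lieBracketWithin]
  exact congrFun lieBracketWithin_univ z

omit [FiniteDimensional ℂ E] in
theorem mlieBracket_const (e e' z : E) :
    mlieBracket 𝓘(ℂ, E) (fun _ : E => e) (fun _ => e') z = 0 := by
  refine (mlieBracket_model_space _ _ z).trans ?_
  have h : lieBracket ℂ (fun _ : E => e) (fun _ => e') z = 0 := by simp [lieBracket]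
  exact h

omit [FiniteDimensional ℂ E] in
theorem differentiableFieldAt_const (e z : E) :
    DifferentiableFieldAt 𝓘(ℂ, E) (fun _ : E => e) z := by
  have h : constField 𝓘(ℂ, E) z e = fun _ => e := by
    funext y
    rw [constField, TangentBundle.symmL_model_space]
    rfl
  exact h ▸ (holomorphicFieldAt_constField (I := 𝓘(ℂ, E)) z e).differentiable

/-- The vertical lift of a vector field of `M` to `X = T_M`, constant along the fibres. -/
def vertLift (a : Π m : M, TangentSpace 𝓘(ℂ, E) m) (x : TangentBundle 𝓘(ℂ, E) M) :
    TangentSpace 𝓘(ℂ, E).tangent x :=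
  vert x (a x.proj)

/-- The horizontal lift of a vector field of `M` to `X = T_M`. -/
def NonlinearConnection.horLift (h : NonlinearConnection E M)
    (a : Π m : M, TangentSpace 𝓘(ℂ, E) m) (x : TangentBundle 𝓘(ℂ, E) M) :
    TangentSpace 𝓘(ℂ, E).tangent x :=
  h.lift x (a x.proj)

omit [FiniteDimensional ℂ E] in
theorem HolomorphicFieldAt.vertLift (ha : HolomorphicFieldAt 𝓘(ℂ, E) a x.proj) :
    HolomorphicFieldAt 𝓘(ℂ, E).tangent (vertLift a) x :=
  holomorphicFieldAt_vert ha

omit [FiniteDimensional ℂ E] in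
theorem HolomorphicFieldAt.horLift (h : NonlinearConnection E M)
    (ha : HolomorphicFieldAt 𝓘(ℂ, E) a x.proj) :
    HolomorphicFieldAt 𝓘(ℂ, E).tangent (h.horLift a) x :=
  h.holomorphic x a ha

/-- Vertical lifts commute: they are constant vector fields on the fibres. -/
theorem mlieBracket_vertLift_vertLift (ha : HolomorphicFieldAt 𝓘(ℂ, E) a x.proj)
    (hb : HolomorphicFieldAt 𝓘(ℂ, E) b x.proj) :
    mlieBracket 𝓘(ℂ, E).tangent (vertLift a) (vertLift b) x = 0 := by
  have : CompleteSpace E := FiniteDimensional.complete ℂ E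
  have h := mfderiv_mlieBracket_of_related (f := fibreIncl (E := E) x.proj)
    (x := (show E from x.snd)) (V := fun _ => a x.proj) (W := fun _ => b x.proj)
    ((contMDiff_fibreIncl x.proj _).of_le le_top) (differentiableFieldAt_const _ _)
    (differentiableFieldAt_const _ _)
    (ha.vertLift (x := x)).differentiable (hb.vertLift (x := x)).differentiable
    (.of_forall fun y => rfl) (.of_forall fun y => rfl)
  exact h.symm.trans ((congrArg _ (mlieBracket_const (E := E) _ _ _)).trans (map_zero _))

namespace NonlinearConnection
variable (h : NonlinearConnection E M)
  {σ : Π m : M, LinearMap.BilinForm ℂ (TangentSpace 𝓘(ℂ, E) m)}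

/-- The vertical field `[h a, v b]` at `x`, regarded as a tangent vector of `M`; its components
generalize the Christoffel symbols of a linear connection. -/
def vertBracket (a b : Π m : M, TangentSpace 𝓘(ℂ, E) m) (x : TangentBundle 𝓘(ℂ, E) M) :
    TangentSpace 𝓘(ℂ, E) x.proj :=
  h.vPart x (mlieBracket 𝓘(ℂ, E).tangent (h.horLift a) (vertLift b) x)

variable (ha : HolomorphicFieldAt 𝓘(ℂ, E) a x.proj) (hb : HolomorphicFieldAt 𝓘(ℂ, E) b x.proj)
include ha hb

theorem projDeriv_mlieBracket_horLift_horLift :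
    projDeriv x (mlieBracket 𝓘(ℂ, E).tangent (h.horLift a) (h.horLift b) x)
      = mlieBracket 𝓘(ℂ, E) a b x.proj :=
  projDeriv_mlieBracket (ha.horLift h).differentiable (hb.horLift h).differentiable
    ha.differentiable hb.differentiable (.of_forall fun _ => h.proj_lift _ _)
    (.of_forall fun _ => h.proj_lift _ _)

theorem projDeriv_mlieBracket_horLift_vertLift :
    projDeriv x (mlieBracket 𝓘(ℂ, E).tangent (h.horLift a) (vertLift b) x) = 0 := by
  have h0 : HolomorphicFieldAt 𝓘(ℂ, E) (0 : Π m : M, TangentSpace 𝓘(ℂ, E) m) x.proj :=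
    Bundle.contMDiff_zeroSection ℂ (TangentSpace 𝓘(ℂ, E)) x.proj
  have h1 := projDeriv_mlieBracket (ha.horLift h).differentiable
    (hb.vertLift (x := x)).differentiable
    ha.differentiable h0.differentiable (.of_forall fun _ => h.proj_lift _ _)
    (.of_forall fun _ => projDeriv_vert _ _)
  rwa [mlieBracket_zero_right] at h1

theorem mlieBracket_horLift_vertLift :
    mlieBracket 𝓘(ℂ, E).tangent (h.horLift a) (vertLift b) x = vert x (h.vertBracket a b x) := by
  have h1 := h.projDeriv_mlieBracket_horLift_vertLift ha hb
  rw [← hPart_eq_projDeriv] at h1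
  conv_lhs => rw [← h.lift_add_vert (mlieBracket _ _ _ _), h1, map_zero, zero_add]
  rfl

end NonlinearConnection
end LiftBrackets

/-! ### Flatness and preservation of the relative symplectic form, tested on lifts -/

section Tensorial
open VectorField
variable {E : Type*} [NormedAddCommGroup E] [NormedSpace ℂ E] [FiniteDimensional ℂ E]
  {H : Type*} [TopologicalSpace H] {I : ModelWithCorners ℂ E H}
  {X : Type*} [TopologicalSpace X] [ChartedSpace H X] [IsManifold I ω X]
  {P Q : Π x : X, Module.End ℂ (TangentSpace I x)}
  {U V W : Π x : X, TangentSpace I x} {x : X}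

/-- The obstruction to `[im P, im P] ⊆ ker Q` is a tensor. -/
theorem tensorialAt_frobenius (hP : IsHolomorphicEnd I P) (hQP : ∀ y u, Q y (P y u) = 0)
    (W : Π x : X, TangentSpace I x) :
    TensorialAt I E
      (fun V => Q x (mlieBracket I (fun y => P y (V y)) (fun y => P y (W y)) x)) x where
  smul {f V} hf hV := by
    have : CompleteSpace E := FiniteDimensional.complete ℂ E
    have h : (fun y => P y ((f • V) y)) = f • fun y => P y (V y) := by
      funext y; simp
    rw [h, mlieBracket_smul_left hf (hP.differentiableFieldAt hV)]
    simp [hQP]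
  add {V V'} hV hV' := by
    have : CompleteSpace E := FiniteDimensional.complete ℂ E
    have h : (fun y => P y ((V + V') y)) = (fun y => P y (V y)) + fun y => P y (V' y) := by
      funext y; simp
    rw [h, mlieBracket_add_left (hP.differentiableFieldAt hV) (hP.differentiableFieldAt hV'),
      map_add]

variable {Ω : Π x : X, LinearMap.BilinForm ℂ (TangentSpace I x)}

variable (P Q Ω) in
/-- The Lie derivative of the form `Ω` along `P U`, evaluated at `Q V` and `Q W`. -/
def lieDerivForm (U V W : Π x : X, TangentSpace I x) (x : X) : ℂ :=
  mvfderiv I (fun y => Ω y (Q y (V y)) (Q y (W y))) x (P x (U x))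
    - Ω x (mlieBracket I (fun y => P y (U y)) (fun y => Q y (V y)) x) (Q x (W x))
    - Ω x (Q x (V x)) (mlieBracket I (fun y => P y (U y)) (fun y => Q y (W y)) x)

/-- The terms with a derivative of `f` in `[f P U, Q V]` are multiples of `P U`, on which `Ω`
vanishes. -/
theorem tensorialAt_lieDerivForm_left (hP : IsHolomorphicEnd I P)
    (h₁ : ∀ y u w, Ω y (P y u) w = 0) (h₂ : ∀ y u w, Ω y w (P y u) = 0)
    (V W : Π x : X, TangentSpace I x) :
    TensorialAt I E (fun U => lieDerivForm P Q Ω U V W x) x where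
  smul {f U} hf hU := by
    have : CompleteSpace E := FiniteDimensional.complete ℂ E
    have h : (fun y => P y ((f • U) y)) = f • fun y => P y (U y) := by
      funext y; simp
    simp only [lieDerivForm]
    rw [h, mlieBracket_smul_left hf (hP.differentiableFieldAt hU),
      mlieBracket_smul_left hf (hP.differentiableFieldAt hU)]
    simp [h₁, h₂]
    ring
  add {U U'} hU hU' := by
    have : CompleteSpace E := FiniteDimensional.complete ℂ E
    have h : (fun y => P y ((U + U') y)) = (fun y => P y (U y)) + fun y => P y (U' y) := by
      funext y; simp
    simp only [lieDerivForm]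
    rw [h, mlieBracket_add_left (hP.differentiableFieldAt hU) (hP.differentiableFieldAt hU'),
      mlieBracket_add_left (hP.differentiableFieldAt hU) (hP.differentiableFieldAt hU')]
    simp only [map_add, Pi.add_apply, LinearMap.add_apply]
    ring

theorem tensorialAt_lieDerivForm_mid (hQ : IsHolomorphicEnd I Q) (hΩ : IsHolomorphicBilin I Ω)
    (U : Π x : X, TangentSpace I x) (hW : DifferentiableFieldAt I W x) :
    TensorialAt I E (fun V => lieDerivForm P Q Ω U V W x) x where
  smul {f V} hf hV := by
    have : CompleteSpace E := FiniteDimensional.complete ℂ E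
    have h : (fun y => Q y ((f • V) y)) = f • fun y => Q y (V y) := by
      funext y; simp
    have h' := hΩ.mvfderiv_smul_left hf (hQ.differentiableFieldAt hV)
      (hQ.differentiableFieldAt hW) (P x (U x))
    rw [← h] at h'
    simp only [lieDerivForm]
    rw [h', h, mlieBracket_smul_right hf (hQ.differentiableFieldAt hV)]
    simp
    ring
  add {V V'} hV hV' := by
    have : CompleteSpace E := FiniteDimensional.complete ℂ E
    have h : (fun y => Q y ((V + V') y)) = (fun y => Q y (V y)) + fun y => Q y (V' y) := by
      funext y; simp
    have h' := hΩ.mvfderiv_add_left (hQ.differentiableFieldAt hV)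
      (hQ.differentiableFieldAt hV') (hQ.differentiableFieldAt hW) (P x (U x))
    rw [← h] at h'
    simp only [lieDerivForm]
    rw [h', h, mlieBracket_add_right (hQ.differentiableFieldAt hV) (hQ.differentiableFieldAt hV')]
    simp only [map_add, Pi.add_apply, LinearMap.add_apply]
    ring

theorem tensorialAt_lieDerivForm_right (hQ : IsHolomorphicEnd I Q) (hΩ : IsHolomorphicBilin I Ω)
    (U : Π x : X, TangentSpace I x) (hV : DifferentiableFieldAt I V x) :
    TensorialAt I E (fun W => lieDerivForm P Q Ω U V W x) x where
  smul {f W} hf hW := by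
    have : CompleteSpace E := FiniteDimensional.complete ℂ E
    have h : (fun y => Q y ((f • W) y)) = f • fun y => Q y (W y) := by
      funext y; simp
    have h' := hΩ.mvfderiv_smul_right hf (hQ.differentiableFieldAt hV)
      (hQ.differentiableFieldAt hW) (P x (U x))
    rw [← h] at h'
    simp only [lieDerivForm]
    rw [h', h, mlieBracket_smul_right hf (hQ.differentiableFieldAt hW)]
    simp
    ring
  add {W W'} hW hW' := by
    have : CompleteSpace E := FiniteDimensional.complete ℂ E
    have h : (fun y => Q y ((W + W') y)) = (fun y => Q y (W y)) + fun y => Q y (W' y) := by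
      funext y; simp
    have h' := hΩ.mvfderiv_add_right (hQ.differentiableFieldAt hV)
      (hQ.differentiableFieldAt hW) (hQ.differentiableFieldAt hW') (P x (U x))
    rw [← h] at h'
    simp only [lieDerivForm]
    rw [h', h, mlieBracket_add_right (hQ.differentiableFieldAt hW) (hQ.differentiableFieldAt hW')]
    simp only [map_add, Pi.add_apply]
    ring

end Tensorial

section Characterizations
open VectorField
variable {E : Type*} [NormedAddCommGroup E] [NormedSpace ℂ E] [FiniteDimensional ℂ E]
  {M : Type*} [TopologicalSpace M] [ChartedSpace E M] [IsManifold 𝓘(ℂ, E) ω M]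

namespace NonlinearConnection
variable (h : NonlinearConnection E M)
  {σ : Π m : M, LinearMap.BilinForm ℂ (TangentSpace 𝓘(ℂ, E) m)}

/-- Flatness may be tested on horizontal lifts of vector fields of `M`. -/
theorem isFlat_iff : h.IsFlat ↔ ∀ (x : TangentBundle 𝓘(ℂ, E) M)
    (a b : Π m : M, TangentSpace 𝓘(ℂ, E) m),
    HolomorphicFieldAt 𝓘(ℂ, E) a x.proj → HolomorphicFieldAt 𝓘(ℂ, E) b x.proj →
      mlieBracket 𝓘(ℂ, E).tangent (h.horLift a) (h.horLift b) x
        = h.lift x (mlieBracket 𝓘(ℂ, E) a b x.proj) := by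
  constructor
  · intro hf x a b ha hb
    obtain ⟨c, hc⟩ := hf x _ _ (ha.horLift h) (hb.horLift h) (.of_forall fun y => ⟨_, rfl⟩)
      (.of_forall fun y => ⟨_, rfl⟩)
    have h1 := h.projDeriv_mlieBracket_horLift_horLift ha hb
    rw [← hc, h.proj_lift] at h1
    rw [← hc, h1]
  · -- the fields `V = P V` and `W = P W` may be replaced by lifts with the same value at `x`, where
    -- `P` is the horizontal projection
    intro hf x V W hV hW hVh hWh
    obtain ⟨a, ha, hax⟩ := exists_holomorphicField (I := 𝓘(ℂ, E)) x.proj (projDeriv x (V x))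
    obtain ⟨b, hb, hbx⟩ := exists_holomorphicField (I := 𝓘(ℂ, E)) x.proj (projDeriv x (W x))
    have hP : ∀ V : Π x : TangentBundle 𝓘(ℂ, E) M, TangentSpace 𝓘(ℂ, E).tangent x,
        (∀ᶠ y in 𝓝 x, V y ∈ h.horizontal y) → (fun y => h.horProj y (V y)) =ᶠ[𝓝 x] V := by
      intro V hV
      filter_upwards [hV] with y hy
      obtain ⟨c, hc⟩ := hy
      rw [← hc, horProj, LinearMap.comp_apply, h.proj_lift]
    have hPl : ∀ a : Π m : M, TangentSpace 𝓘(ℂ, E) m,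
        (fun y => h.horProj y (h.horLift a y)) = h.horLift a := fun a => by
      funext y
      rw [horLift, horProj, LinearMap.comp_apply, h.proj_lift]
    have hVx : V x = h.horLift a x := by
      rw [← (hP V hVh).self_of_nhds, horLift, hax]; rfl
    have hWx : W x = h.horLift b x := by
      rw [← (hP W hWh).self_of_nhds, horLift, hbx]; rfl
    have hQP : ∀ y u, h.vertProj y (h.horProj y u) = 0 := fun y u => by
      simp [horProj, vertProj, h.vPart_lift]
    have hT := h.isHolomorphicEnd_horProj
    have key : h.vertProj x (mlieBracket 𝓘(ℂ, E).tangent V W x) = 0 := by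
      rw [← (hP V hVh).mlieBracket_vectorField_eq (hP W hWh)]
      rw [TensorialAt.pointwise (tensorialAt_frobenius hT hQP W) hV.differentiable
        (ha.horLift h).differentiable hVx, mlieBracket_swap_apply, map_neg,
        TensorialAt.pointwise (tensorialAt_frobenius hT hQP _) hW.differentiable
        (hb.horLift h).differentiable hWx, ← map_neg, ← mlieBracket_swap_apply, hPl, hPl,
        hf x a b ha hb]
      simp [vertProj, h.vPart_lift]
    refine ⟨h.hPart x (mlieBracket 𝓘(ℂ, E).tangent V W x), ?_⟩
    conv_rhs => rw [← h.lift_add_vert (mlieBracket _ _ _ _)]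
    exact ((add_zero _).symm.trans (congrArg _ key.symm))

/-- Being symplectic may be tested on lifts of vector fields of `M`. -/
theorem isSymplectic_iff (hσ : IsHolomorphicBilin 𝓘(ℂ, E) σ) :
    h.IsSymplectic σ ↔ ∀ (x : TangentBundle 𝓘(ℂ, E) M)
      (c a b : Π m : M, TangentSpace 𝓘(ℂ, E) m), HolomorphicFieldAt 𝓘(ℂ, E) c x.proj →
      HolomorphicFieldAt 𝓘(ℂ, E) a x.proj → HolomorphicFieldAt 𝓘(ℂ, E) b x.proj →
        mvfderiv 𝓘(ℂ, E).tangent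
          (fun y : TangentBundle 𝓘(ℂ, E) M => σ y.proj (a y.proj) (b y.proj)) x (h.horLift c x)
          = σ x.proj (h.vertBracket c a x) (b x.proj)
            + σ x.proj (a x.proj) (h.vertBracket c b x) := by
  have hΩv : ∀ a b : Π m : M, TangentSpace 𝓘(ℂ, E) m,
      (fun y : TangentBundle 𝓘(ℂ, E) M => h.relativeForm σ y (vertLift a y) (vertLift b y))
        = fun y => σ y.proj (a y.proj) (b y.proj) := fun a b => by
    funext y
    simp [relativeForm, vertLift, h.vPart_vert]
  have hL : ∀ (x : TangentBundle 𝓘(ℂ, E) M) (c a b : Π m : M, TangentSpace 𝓘(ℂ, E) m),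
      (mvfderiv 𝓘(ℂ, E).tangent (fun y => h.relativeForm σ y (vertLift a y) (vertLift b y)) x
        (h.horLift c x)
      - h.relativeForm σ x (mlieBracket 𝓘(ℂ, E).tangent (h.horLift c) (vertLift a) x)
        (vertLift b x)
      - h.relativeForm σ x (vertLift a x)
        (mlieBracket 𝓘(ℂ, E).tangent (h.horLift c) (vertLift b) x) = 0) ↔
      mvfderiv 𝓘(ℂ, E).tangent
          (fun y : TangentBundle 𝓘(ℂ, E) M => σ y.proj (a y.proj) (b y.proj)) x (h.horLift c x)
          = σ x.proj (h.vertBracket c a x) (b x.proj)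
            + σ x.proj (a x.proj) (h.vertBracket c b x) := fun x c a b => by
    rw [hΩv, sub_sub, sub_eq_zero]
    simp only [relativeForm, LinearMap.compl₁₂_apply, vertLift, h.vPart_vert]
    rfl
  constructor
  · intro hs x c a b hc ha hb
    exact (hL x c a b).1 (hs x _ _ _ (hc.horLift h) ha.vertLift hb.vertLift
      (.of_forall fun y => ⟨_, rfl⟩) (.of_forall fun y => projDeriv_vert _ _)
      (.of_forall fun y => projDeriv_vert _ _))
  · -- as in `isFlat_iff`, the three fields may be replaced by lifts with the same value at `x`
    intro hs x U V W hU hV hW hUh hVv hWv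
    obtain ⟨c, hc, hcx⟩ := exists_holomorphicField (I := 𝓘(ℂ, E)) x.proj (projDeriv x (U x))
    obtain ⟨a, ha, hax⟩ := exists_holomorphicField (I := 𝓘(ℂ, E)) x.proj (h.vPart x (V x))
    obtain ⟨b, hb, hbx⟩ := exists_holomorphicField (I := 𝓘(ℂ, E)) x.proj (h.vPart x (W x))
    have hP : (fun y => h.horProj y (U y)) =ᶠ[𝓝 x] U := by
      filter_upwards [hUh] with y hy
      obtain ⟨c, hc⟩ := hy
      rw [← hc, horProj, LinearMap.comp_apply, h.proj_lift]
    have hQ : ∀ V : Π x : TangentBundle 𝓘(ℂ, E) M, TangentSpace 𝓘(ℂ, E).tangent x,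
        (∀ᶠ y in 𝓝 x, projDeriv y (V y) = 0) → (fun y => h.vertProj y (V y)) =ᶠ[𝓝 x] V := by
      intro V hV
      filter_upwards [hV] with y hy
      rw [← hPart_eq_projDeriv h] at hy
      conv_rhs => rw [← h.lift_add_vert (V y), hy, map_zero, zero_add]
      rfl
    have hPl : (fun y => h.horProj y (h.horLift c y)) = h.horLift c := by
      funext y
      rw [horLift, horProj, LinearMap.comp_apply, h.proj_lift]
    have hQl : ∀ a : Π m : M, TangentSpace 𝓘(ℂ, E) m,
        (fun y => h.vertProj y (vertLift a y)) = vertLift a := fun a => by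
      funext y
      rw [vertLift, vertProj, LinearMap.comp_apply, h.vPart_vert]
    have hUx : U x = h.horLift c x := by
      rw [← hP.self_of_nhds, horLift, hcx]; rfl
    have hVx : V x = vertLift a x := by
      rw [← (hQ V hVv).self_of_nhds, vertLift, hax]; rfl
    have hWx : W x = vertLift b x := by
      rw [← (hQ W hWv).self_of_nhds, vertLift, hbx]; rfl
    have hΩ : IsHolomorphicBilin 𝓘(ℂ, E).tangent (h.relativeForm σ) := fun x V W hV hW =>
      contMDiffAt_bilin_along hσ (h.holomorphicAlongAt_vPart hV) (h.holomorphicAlongAt_vPart hW)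
    have h₁ : ∀ y u w, h.relativeForm σ y (h.horProj y u) w = 0 := fun y u w => by
      simp [relativeForm, horProj, h.vPart_lift]
    have h₂ : ∀ y u w, h.relativeForm σ y w (h.horProj y u) = 0 := fun y u w => by
      simp [relativeForm, horProj, h.vPart_lift]
    have key : lieDerivForm h.horProj h.vertProj (h.relativeForm σ) U V W x = 0 := by
      rw [TensorialAt.pointwise (tensorialAt_lieDerivForm_left h.isHolomorphicEnd_horProj h₁ h₂
          V W) hU.differentiable (hc.horLift h).differentiable hUx,
        TensorialAt.pointwise (tensorialAt_lieDerivForm_mid h.isHolomorphicEnd_vertProj hΩ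
          _ hW.differentiable) hV.differentiable ha.vertLift.differentiable hVx,
        TensorialAt.pointwise (tensorialAt_lieDerivForm_right h.isHolomorphicEnd_vertProj hΩ
          _ ha.vertLift.differentiable) hW.differentiable hb.vertLift.differentiable hWx]
      have h3 := (hL x c a b).2 (hs x c a b hc ha hb)
      simp only [lieDerivForm]
      rw [hPl, hQl, hQl, congrFun hPl x, congrFun (hQl a) x, congrFun (hQl b) x]
      simpa only [congrFun (hQl _) _] using h3
    have hD : (fun y => h.relativeForm σ y (h.vertProj y (V y)) (h.vertProj y (W y)))
        =ᶠ[𝓝 x] fun y => h.relativeForm σ y (V y) (W y) := by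
      filter_upwards [hQ V hVv, hQ W hWv] with y hy hy'
      rw [hy, hy']
    rw [lieDerivForm, mvfderiv, hD.mfderiv_eq, hP.mlieBracket_vectorField_eq (hQ V hVv),
      hP.mlieBracket_vectorField_eq (hQ W hWv)] at key
    simp only [hP.self_of_nhds, (hQ V hVv).self_of_nhds, (hQ W hWv).self_of_nhds] at key
    exact key

end NonlinearConnection
end Characterizations

/-! ### The pencil `h + ε⁻¹ v` -/

section Pencil
open VectorField
variable {E : Type*} [NormedAddCommGroup E] [NormedSpace ℂ E] [FiniteDimensional ℂ E]
  {M : Type*} [TopologicalSpace M] [ChartedSpace E M] [IsManifold 𝓘(ℂ, E) ω M]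

omit [FiniteDimensional ℂ E] in
/-- Functions pulled back from `M` are constant along the fibres of `T_M`. -/
theorem mvfderiv_comp_proj_vert {f : M → ℂ} {x : TangentBundle 𝓘(ℂ, E) M}
    (hf : MDifferentiableAt 𝓘(ℂ, E) 𝓘(ℂ) f x.proj) (u : TangentSpace 𝓘(ℂ, E) x.proj) :
    mvfderiv 𝓘(ℂ, E).tangent (fun y : TangentBundle 𝓘(ℂ, E) M => f y.proj) x (vert x u) = 0 := by
  have hπ : MDifferentiableAt 𝓘(ℂ, E).tangent 𝓘(ℂ, E)
      (Bundle.TotalSpace.proj : TangentBundle 𝓘(ℂ, E) M → M) x :=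
    (Bundle.contMDiffAt_proj (TangentSpace 𝓘(ℂ, E)) (n := ω)).mdifferentiableAt (by simp)
  have h1 : mfderiv 𝓘(ℂ, E).tangent 𝓘(ℂ, E)
      (Bundle.TotalSpace.proj : TangentBundle 𝓘(ℂ, E) M → M) x (vert x u) = 0 := projDeriv_vert x u
  refine (mfderiv_comp_apply x hf hπ (vert x u)).trans ?_
  rw [h1]
  exact map_zero _

namespace NonlinearConnection
variable (h : NonlinearConnection E M)
  {σ : Π m : M, LinearMap.BilinForm ℂ (TangentSpace 𝓘(ℂ, E) m)}
  {x : TangentBundle 𝓘(ℂ, E) M} {a b : Π m : M, TangentSpace 𝓘(ℂ, E) m}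

omit [FiniteDimensional ℂ E] in
theorem horLift_pencil (ε : ℂ) (a : Π m : M, TangentSpace 𝓘(ℂ, E) m) :
    (h.pencil ε).horLift a = h.horLift a + ε⁻¹ • vertLift a := rfl

section
variable (ha : HolomorphicFieldAt 𝓘(ℂ, E) a x.proj) (hb : HolomorphicFieldAt 𝓘(ℂ, E) b x.proj)
include ha hb

theorem mlieBracket_vertLift_horLift :
    mlieBracket 𝓘(ℂ, E).tangent (vertLift a) (h.horLift b) x = - vert x (h.vertBracket b a x) := by
  rw [mlieBracket_swap_apply, h.mlieBracket_horLift_vertLift hb ha]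

theorem mlieBracket_horLift_pencil (ε : ℂ) :
    mlieBracket 𝓘(ℂ, E).tangent ((h.pencil ε).horLift a) ((h.pencil ε).horLift b) x
      = mlieBracket 𝓘(ℂ, E).tangent (h.horLift a) (h.horLift b) x
        + ε⁻¹ • vert x (h.vertBracket a b x - h.vertBracket b a x) := by
  have : CompleteSpace E := FiniteDimensional.complete ℂ E
  have hva := (ha.vertLift (x := x)).differentiable
  have hvb := (hb.vertLift (x := x)).differentiable
  have hha := (ha.horLift h).differentiable
  have hhb := (hb.horLift h).differentiable
  have hva' : DifferentiableFieldAt 𝓘(ℂ, E).tangent (ε⁻¹ • vertLift a) x :=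
    mdifferentiableAt_const.smul_section hva
  have hvb' : DifferentiableFieldAt 𝓘(ℂ, E).tangent (ε⁻¹ • vertLift b) x :=
    mdifferentiableAt_const.smul_section hvb
  rw [horLift_pencil, horLift_pencil, mlieBracket_add_left hha hva',
    mlieBracket_add_right hhb hvb', mlieBracket_add_right hhb hvb',
    mlieBracket_const_smul_left hva, mlieBracket_const_smul_left hva,
    mlieBracket_const_smul_right hvb, mlieBracket_const_smul_right hvb,
    mlieBracket_vertLift_vertLift ha hb, h.mlieBracket_horLift_vertLift ha hb,
    h.mlieBracket_vertLift_horLift ha hb, map_sub]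
  module

theorem vertBracket_pencil (ε : ℂ) : (h.pencil ε).vertBracket a b x = h.vertBracket a b x := by
  have : CompleteSpace E := FiniteDimensional.complete ℂ E
  have hva := (ha.vertLift (x := x)).differentiable
  have hva' : DifferentiableFieldAt 𝓘(ℂ, E).tangent (ε⁻¹ • vertLift a) x :=
    mdifferentiableAt_const.smul_section hva
  rw [vertBracket, horLift_pencil, mlieBracket_add_left (ha.horLift h).differentiable hva',
    mlieBracket_const_smul_left hva, mlieBracket_vertLift_vertLift ha hb,
    h.mlieBracket_horLift_vertLift ha hb, smul_zero, add_zero, vPart_vert]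

end

/-- The curvature of `h_ε` is a polynomial in `ε⁻¹`, whose coefficients vanish if and only if `h`
is flat and torsion-free. -/
theorem forall_isFlat_pencil_iff :
    (∀ ε : ℂ, ε ≠ 0 → (h.pencil ε).IsFlat) ↔ h.IsFlat ∧
      ∀ (x : TangentBundle 𝓘(ℂ, E) M) (a b : Π m : M, TangentSpace 𝓘(ℂ, E) m),
        HolomorphicFieldAt 𝓘(ℂ, E) a x.proj → HolomorphicFieldAt 𝓘(ℂ, E) b x.proj →
          h.vertBracket a b x - h.vertBracket b a x = mlieBracket 𝓘(ℂ, E) a b x.proj := by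
  constructor
  · intro hf
    have key : ∀ (x : TangentBundle 𝓘(ℂ, E) M) (a b : Π m : M, TangentSpace 𝓘(ℂ, E) m),
        HolomorphicFieldAt 𝓘(ℂ, E) a x.proj → HolomorphicFieldAt 𝓘(ℂ, E) b x.proj →
        ∀ ε : ℂ, ε ≠ 0 → mlieBracket 𝓘(ℂ, E).tangent (h.horLift a) (h.horLift b) x
          + ε⁻¹ • vert x (h.vertBracket a b x - h.vertBracket b a x)
          = h.lift x (mlieBracket 𝓘(ℂ, E) a b x.proj)
            + ε⁻¹ • vert x (mlieBracket 𝓘(ℂ, E) a b x.proj) := by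
      intro x a b ha hb ε hε
      rw [← h.mlieBracket_horLift_pencil ha hb]
      exact (h.pencil ε).isFlat_iff.1 (hf ε hε) x a b ha hb
    -- two values of `ε` suffice
    refine ⟨h.isFlat_iff.2 fun x a b ha hb => ?_, fun x a b ha hb => ?_⟩
    all_goals
      have h₁ := key x a b ha hb 1 one_ne_zero
      have h₂ := key x a b ha hb (-1) (by simp)
      rw [inv_one, one_smul, one_smul] at h₁
      rw [inv_neg, inv_one, neg_one_smul, neg_one_smul] at h₂
    · linear_combination (norm := module) (1 / 2 : ℂ) • h₁ + (1 / 2 : ℂ) • h₂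
    · refine vert_injective x ?_
      linear_combination (norm := module) (1 / 2 : ℂ) • h₁ - (1 / 2 : ℂ) • h₂
  · rintro ⟨hf, ht⟩ ε -
    refine (h.pencil ε).isFlat_iff.2 fun x a b ha hb => ?_
    rw [h.mlieBracket_horLift_pencil ha hb, h.isFlat_iff.1 hf x a b ha hb, ht x a b ha hb]
    rfl

/-- Vertical lifts preserve the relative symplectic form, so that adding a multiple of `v` to `h`
does not affect whether it is preserved by horizontal fields. -/
theorem isSymplectic_pencil_iff (hσ : IsHolomorphicBilin 𝓘(ℂ, E) σ) (ε : ℂ) :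
    (h.pencil ε).IsSymplectic σ ↔ h.IsSymplectic σ := by
  rw [isSymplectic_iff _ hσ, isSymplectic_iff _ hσ]
  refine forall_congr' fun x => forall_congr' fun c => forall_congr' fun a => forall_congr' fun b =>
    forall_congr' fun hc => forall_congr' fun ha => forall_congr' fun hb => ?_
  have h1 : mvfderiv 𝓘(ℂ, E).tangent
      (fun y : TangentBundle 𝓘(ℂ, E) M => σ y.proj (a y.proj) (b y.proj)) x
        ((h.pencil ε).horLift c x) = mvfderiv 𝓘(ℂ, E).tangent
      (fun y : TangentBundle 𝓘(ℂ, E) M => σ y.proj (a y.proj) (b y.proj)) x (h.horLift c x) := by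
    rw [horLift_pencil, Pi.add_apply, Pi.smul_apply, map_add, map_smul, vertLift,
      mvfderiv_comp_proj_vert ((hσ _ _ _ ha hb).mdifferentiableAt (by simp)), smul_zero, add_zero]
  rw [h1, h.vertBracket_pencil hc ha, h.vertBracket_pencil hc hb]

end NonlinearConnection
end Pencil

/-! ### Parallel endomorphisms -/

section Parallel
open VectorField
variable {E : Type*} [NormedAddCommGroup E] [NormedSpace ℂ E] [FiniteDimensional ℂ E]
  {H : Type*} [TopologicalSpace H] {I : ModelWithCorners ℂ E H}
  {X : Type*} [TopologicalSpace X] [ChartedSpace H X] [IsManifold I ω X]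

/-- The covariant derivative of an endomorphism field is a tensor. -/
theorem tensorialAt_cov_end (cov : CovariantDerivative I E (TangentSpace I : X → Type _))
    {R : Π x : X, Module.End ℂ (TangentSpace I x)} (hR : IsHolomorphicEnd I R) (x : X)
    (u : TangentSpace I x) :
    TensorialAt I E (fun V => cov (fun y => R y (V y)) x u - R x (cov V x u)) x where
  smul {f V} hf hV := by
    have h : (fun y => R y ((f • V) y)) = f • fun y => R y (V y) := by
      funext y; simp
    rw [h, cov.isCovariantDerivativeOn.leibniz (s := Set.univ) (hR.differentiableFieldAt hV) hf,
      cov.isCovariantDerivativeOn.leibniz (s := Set.univ) hV hf]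
    simp [smul_sub]
  add {V V'} hV hV' := by
    have h : (fun y => R y ((V + V') y)) = (fun y => R y (V y)) + fun y => R y (V' y) := by
      funext y; simp
    rw [h, cov.isCovariantDerivativeOn.add (s := Set.univ) (hR.differentiableFieldAt hV)
      (hR.differentiableFieldAt hV'), cov.isCovariantDerivativeOn.add (s := Set.univ) hV hV']
    simp only [add_apply, map_add]
    abel

end Parallel

section HyperkahlerConnection
open VectorField
variable {E : Type*} [NormedAddCommGroup E] [NormedSpace ℂ E] [FiniteDimensional ℂ E]
  {M : Type*} [TopologicalSpace M] [ChartedSpace E M] [IsManifold 𝓘(ℂ, E) ω M]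

namespace NonlinearConnection
variable (h : NonlinearConnection E M)
  {σ : Π m : M, LinearMap.BilinForm ℂ (TangentSpace 𝓘(ℂ, E) m)}
  {cov : CovariantDerivative 𝓘(ℂ, E).tangent (E × E)
    (TangentSpace 𝓘(ℂ, E).tangent : TangentBundle 𝓘(ℂ, E) M → Type _)}
  {R : Π x : TangentBundle 𝓘(ℂ, E) M, Module.End ℂ (TangentSpace 𝓘(ℂ, E).tangent x)}

variable (cov) in
/-- The connection `cov` on `T_X = π^* T_M ⊗ ℂ²` acts on the first factor only: it preserves `im h`
and `im v`, and acts in the same way on both of them. -/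
def IsDiagonal : Prop :=
  ∀ (x : TangentBundle 𝓘(ℂ, E) M) (a : Π m : M, TangentSpace 𝓘(ℂ, E) m),
    HolomorphicFieldAt 𝓘(ℂ, E) a x.proj → ∀ u, ∃ p : TangentSpace 𝓘(ℂ, E) x.proj,
      cov (h.horLift a) x u = h.lift x p ∧ cov (vertLift a) x u = vert x p

variable {h}

/-- A connection of the form `∇ ⊗ 1` on `T_X = π^* T_M ⊗ ℂ²` commutes with constant endomorphisms
of the second factor. -/
theorem IsDiagonal.isParallel (hc : h.IsDiagonal cov)
    (hR : IsHolomorphicEnd 𝓘(ℂ, E).tangent R) {r₁ r₂ r₃ r₄ : ℂ}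
    (h₁ : ∀ x a, R x (h.lift x a) = r₁ • h.lift x a + r₂ • vert x a)
    (h₂ : ∀ x a, R x (vert x a) = r₃ • h.lift x a + r₄ • vert x a) :
    IsParallel 𝓘(ℂ, E).tangent cov R := by
  intro x V hV u
  obtain ⟨a, ha, hax⟩ := exists_holomorphicField (I := 𝓘(ℂ, E)) x.proj (h.hPart x (V x))
  obtain ⟨b, hb, hbx⟩ := exists_holomorphicField (I := 𝓘(ℂ, E)) x.proj (h.vPart x (V x))
  have hha := (ha.horLift h).differentiable
  have hva := (ha.vertLift (x := x)).differentiable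
  have hhb := (hb.horLift h).differentiable
  have hvb := (hb.vertLift (x := x)).differentiable
  have hsmul : ∀ {W : Π x : TangentBundle 𝓘(ℂ, E) M, TangentSpace 𝓘(ℂ, E).tangent x} (r : ℂ),
      DifferentiableFieldAt 𝓘(ℂ, E).tangent W x →
      DifferentiableFieldAt 𝓘(ℂ, E).tangent (r • W) x := fun r hW =>
    mdifferentiableAt_const.smul_section hW
  have hadd : ∀ {W W' : Π x : TangentBundle 𝓘(ℂ, E) M, TangentSpace 𝓘(ℂ, E).tangent x},
      DifferentiableFieldAt 𝓘(ℂ, E).tangent W x → DifferentiableFieldAt 𝓘(ℂ, E).tangent W' x →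
      DifferentiableFieldAt 𝓘(ℂ, E).tangent (W + W') x := fun hW hW' =>
    mdifferentiableAt_add_section hW hW'
  have hVx : V x = (h.horLift a + vertLift b) x := by
    rw [Pi.add_apply, horLift, vertLift, hax, hbx, h.lift_add_vert]
  have key := (tensorialAt_cov_end cov hR x u).pointwise hV (hadd hha hvb) hVx
  have hRV : (fun y => R y ((h.horLift a + vertLift b) y))
      = (r₁ • h.horLift a + r₂ • vertLift a) + (r₃ • h.horLift b + r₄ • vertLift b) := by
    funext y
    simp [horLift, vertLift, h₁, h₂]
  obtain ⟨p, hp₁, hp₂⟩ := hc x a ha u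
  obtain ⟨q, hq₁, hq₂⟩ := hc x b hb u
  have hcov := cov.isCovariantDerivativeOn (s := Set.univ)
  rw [hRV, hcov.add (hadd (hsmul r₁ hha) (hsmul r₂ hva)) (hadd (hsmul r₃ hhb) (hsmul r₄ hvb)),
    hcov.add (hsmul r₁ hha) (hsmul r₂ hva), hcov.add (hsmul r₃ hhb) (hsmul r₄ hvb),
    hcov.smul_const r₁ hha, hcov.smul_const r₂ hva, hcov.smul_const r₃ hhb, hcov.smul_const r₄ hvb,
    hcov.add hha hvb] at key
  simp only [add_apply, smul_apply, map_add, hp₁, hp₂, hq₁,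
    hq₂, h₁, h₂, sub_self] at key
  exact sub_eq_zero.1 key

theorem IsDiagonal.isParallel_opI (hc : h.IsDiagonal cov) :
    IsParallel 𝓘(ℂ, E).tangent cov h.opI :=
  hc.isParallel h.isHolomorphicEnd_opI (r₁ := Complex.I) (r₂ := 0) (r₃ := 0) (r₄ := -Complex.I)
    (fun x a => by simp [h.opI_lift]) (fun x a => by simp [h.opI_vert])

theorem IsDiagonal.isParallel_opJ (hc : h.IsDiagonal cov) :
    IsParallel 𝓘(ℂ, E).tangent cov h.opJ :=
  hc.isParallel h.isHolomorphicEnd_opJ (r₁ := 0) (r₂ := -1) (r₃ := 1) (r₄ := 0)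
    (fun x a => by simp [h.opJ_lift]) (fun x a => by simp [h.opJ_vert])

theorem IsDiagonal.isParallel_opK (hc : h.IsDiagonal cov) :
    IsParallel 𝓘(ℂ, E).tangent cov h.opK :=
  hc.isParallel h.isHolomorphicEnd_opK (r₁ := 0) (r₂ := Complex.I) (r₃ := Complex.I) (r₄ := 0)
    (fun x a => by simp [h.opK_lift]) (fun x a => by simp [h.opK_vert])

/-- As `im h` is an eigenbundle of `I`, it is preserved by every connection for which `I` is
parallel; and `J` exchanges it with `im v`. -/
theorem isDiagonal_of_isParallel (hI : IsParallel 𝓘(ℂ, E).tangent cov h.opI)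
    (hJ : IsParallel 𝓘(ℂ, E).tangent cov h.opJ) : h.IsDiagonal cov := by
  intro x a ha u
  have hcov := cov.isCovariantDerivativeOn (s := Set.univ)
  have hha := (ha.horLift h).differentiable
  have hva := (ha.vertLift (x := x)).differentiable
  have h₁ := hI x _ hha u
  have hIa : (fun y => h.opI y (h.horLift a y)) = Complex.I • h.horLift a := by
    funext y; exact h.opI_lift y _
  have hJa : (fun y => h.opJ y (h.horLift a y)) = (-1 : ℂ) • vertLift a := by
    funext y; exact (h.opJ_lift y _).trans (neg_one_smul ℂ _).symm
  rw [hIa, hcov.smul_const _ hha, smul_apply,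
    ← h.lift_add_vert (cov _ x u), map_add, opI_lift, opI_vert, smul_add, add_right_inj,
    ← map_smul, ← map_neg] at h₁
  have h₂ : h.vPart x (cov (h.horLift a) x u) = 0 := by
    have h₃ : (2 * Complex.I) • h.vPart x (cov (h.horLift a) x u) = 0 := by
      linear_combination (norm := module) vert_injective x h₁
    exact (smul_eq_zero.1 h₃).resolve_left (by simp)
  have h₄ : cov (h.horLift a) x u = h.lift x (h.hPart x (cov (h.horLift a) x u)) := by
    conv_lhs => rw [← h.lift_add_vert (cov _ x u), h₂, map_zero, add_zero]
  refine ⟨_, h₄, ?_⟩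
  have h₅ := hJ x _ hha u
  rw [hJa, hcov.smul_const _ hva, smul_apply, h₄, opJ_lift, neg_one_smul,
    neg_inj] at h₅
  exact h₅

end NonlinearConnection
end HyperkahlerConnection

/-! ### The Levi-Civita connection and the pencil -/

section LeviCivita
open VectorField
variable {E : Type*} [NormedAddCommGroup E] [NormedSpace ℂ E] [FiniteDimensional ℂ E]
  {M : Type*} [TopologicalSpace M] [ChartedSpace E M] [IsManifold 𝓘(ℂ, E) ω M]

namespace NonlinearConnection
variable (h : NonlinearConnection E M)
  {σ : Π m : M, LinearMap.BilinForm ℂ (TangentSpace 𝓘(ℂ, E) m)}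
  {x : TangentBundle 𝓘(ℂ, E) M} {a b c : Π m : M, TangentSpace 𝓘(ℂ, E) m}
  {cov : CovariantDerivative 𝓘(ℂ, E).tangent (E × E)
    (TangentSpace 𝓘(ℂ, E).tangent : TangentBundle 𝓘(ℂ, E) M → Type _)}

section MetricDerivatives
variable (w : TangentSpace 𝓘(ℂ, E).tangent x)

theorem mvfderiv_metric_horLift_horLift : mvfderiv 𝓘(ℂ, E).tangent
    (fun y => h.metric σ y (h.horLift a y) (h.horLift b y)) x w = 0 := by
  have h1 : (fun y => h.metric σ y (h.horLift a y) (h.horLift b y)) = 0 := by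
    funext y; exact h.metric_lift_lift σ y _ _
  rw [h1, mvfderiv_zero]
  rfl

theorem mvfderiv_metric_vertLift_vertLift : mvfderiv 𝓘(ℂ, E).tangent
    (fun y => h.metric σ y (vertLift a y) (vertLift b y)) x w = 0 := by
  have h1 : (fun y => h.metric σ y (vertLift a y) (vertLift b y)) = 0 := by
    funext y; exact h.metric_vert_vert σ y _ _
  rw [h1, mvfderiv_zero]
  rfl

variable (hσ : IsHolomorphicBilin 𝓘(ℂ, E) σ)
  (ha : HolomorphicFieldAt 𝓘(ℂ, E) a x.proj) (hb : HolomorphicFieldAt 𝓘(ℂ, E) b x.proj)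
include hσ ha hb

theorem mvfderiv_metric_horLift_vertLift : mvfderiv 𝓘(ℂ, E).tangent
    (fun y => h.metric σ y (h.horLift a y) (vertLift b y)) x w
      = 1 / 2 * mvfderiv 𝓘(ℂ, E).tangent
        (fun y : TangentBundle 𝓘(ℂ, E) M => σ y.proj (a y.proj) (b y.proj)) x w := by
  have h1 : (fun y => h.metric σ y (h.horLift a y) (vertLift b y))
      = (fun _ => (1 / 2 : ℂ)) * fun y => σ y.proj (a y.proj) (b y.proj) := by
    funext y; exact h.metric_lift_vert σ y _ _
  have h2 : MDifferentiableAt 𝓘(ℂ, E).tangent 𝓘(ℂ)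
      (fun y : TangentBundle 𝓘(ℂ, E) M => σ y.proj (a y.proj) (b y.proj)) x :=
    ((hσ _ _ _ ha hb).comp x (Bundle.contMDiffAt_proj (TangentSpace 𝓘(ℂ, E)))).mdifferentiableAt
      (by simp)
  rw [h1, mvfderiv_mul mdifferentiableAt_const h2, mvfderiv_const]
  simp

theorem mvfderiv_metric_vertLift_horLift : mvfderiv 𝓘(ℂ, E).tangent
    (fun y => h.metric σ y (vertLift b y) (h.horLift a y)) x w
      = 1 / 2 * mvfderiv 𝓘(ℂ, E).tangent
        (fun y : TangentBundle 𝓘(ℂ, E) M => σ y.proj (a y.proj) (b y.proj)) x w := by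
  rw [← h.mvfderiv_metric_horLift_vertLift w hσ ha hb]
  have h1 : (fun y => h.metric σ y (vertLift b y) (h.horLift a y))
      = fun y => h.metric σ y (h.horLift a y) (vertLift b y) := by
    funext y; exact (h.metric_vert_lift σ y _ _).trans (h.metric_lift_vert σ y _ _).symm
  rw [h1]

end MetricDerivatives

/-- Tangent vectors are determined by their pairings with lifts. The factor `2` is the one in the
Koszul formula. -/
theorem metric_ext (hσ : IsHolomorphicSymplectic 𝓘(ℂ, E) σ)
    {v v' : TangentSpace 𝓘(ℂ, E).tangent x}
    (h₁ : ∀ d : Π m : M, TangentSpace 𝓘(ℂ, E) m, HolomorphicFieldAt 𝓘(ℂ, E) d x.proj →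
      2 * h.metric σ x v (h.horLift d x) = 2 * h.metric σ x v' (h.horLift d x))
    (h₂ : ∀ d : Π m : M, TangentSpace 𝓘(ℂ, E) m, HolomorphicFieldAt 𝓘(ℂ, E) d x.proj →
      2 * h.metric σ x v (vertLift d x) = 2 * h.metric σ x v' (vertLift d x)) : v = v' := by
  refine (h.isHolomorphicMetric_metric hσ).ext_left fun w => ?_
  obtain ⟨d, hd, hdx⟩ := exists_holomorphicField (I := 𝓘(ℂ, E)) x.proj (h.hPart x w)
  obtain ⟨e, he, hex⟩ := exists_holomorphicField (I := 𝓘(ℂ, E)) x.proj (h.vPart x w)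
  have h₃ := mul_left_cancel₀ two_ne_zero (h₁ d hd)
  have h₄ := mul_left_cancel₀ two_ne_zero (h₂ e he)
  rw [horLift, hdx] at h₃
  rw [vertLift, hex] at h₄
  rw [← h.lift_add_vert w, map_add, map_add, h₃, h₄]

/-- The connection `∇` is given on lifts by `∇_{h c} (h a) = h (Γ (c, a))`,
`∇_{h c} (v a) = v (Γ (c, a))` and `∇_{v c} (h a) = 0 = ∇_{v c} (v a)`, where
`v (Γ (c, a)) = [h c, v a]`. This is the shape of the Levi-Civita connection when the pencil is flat
and symplectic. -/
structure IsBracketConnection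
    (cov : CovariantDerivative 𝓘(ℂ, E).tangent (E × E)
      (TangentSpace 𝓘(ℂ, E).tangent : TangentBundle 𝓘(ℂ, E) M → Type _)) : Prop where
  hor_hor : ∀ (x : TangentBundle 𝓘(ℂ, E) M) (c a : Π m : M, TangentSpace 𝓘(ℂ, E) m),
    HolomorphicFieldAt 𝓘(ℂ, E) c x.proj → HolomorphicFieldAt 𝓘(ℂ, E) a x.proj →
      cov (h.horLift a) x (h.horLift c x) = h.lift x (h.vertBracket c a x)
  hor_vert : ∀ (x : TangentBundle 𝓘(ℂ, E) M) (c a : Π m : M, TangentSpace 𝓘(ℂ, E) m),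
    HolomorphicFieldAt 𝓘(ℂ, E) c x.proj → HolomorphicFieldAt 𝓘(ℂ, E) a x.proj →
      cov (vertLift a) x (h.horLift c x) = vert x (h.vertBracket c a x)
  vert_hor : ∀ (x : TangentBundle 𝓘(ℂ, E) M) (c a : Π m : M, TangentSpace 𝓘(ℂ, E) m),
    HolomorphicFieldAt 𝓘(ℂ, E) c x.proj → HolomorphicFieldAt 𝓘(ℂ, E) a x.proj →
      cov (h.horLift a) x (vertLift c x) = 0
  vert_vert : ∀ (x : TangentBundle 𝓘(ℂ, E) M) (c a : Π m : M, TangentSpace 𝓘(ℂ, E) m),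
    HolomorphicFieldAt 𝓘(ℂ, E) c x.proj → HolomorphicFieldAt 𝓘(ℂ, E) a x.proj →
      cov (vertLift a) x (vertLift c x) = 0

variable {h}

/-- The Koszul formula evaluated on lifts. -/
theorem _root_.PreJoyce.IsLeviCivita.isBracketConnection
    (hσ : IsHolomorphicSymplectic 𝓘(ℂ, E) σ)
    (hcov : IsLeviCivita 𝓘(ℂ, E).tangent (h.metric σ) cov) (hf : h.IsFlat)
    (ht : ∀ (x : TangentBundle 𝓘(ℂ, E) M) (a b : Π m : M, TangentSpace 𝓘(ℂ, E) m),
      HolomorphicFieldAt 𝓘(ℂ, E) a x.proj → HolomorphicFieldAt 𝓘(ℂ, E) b x.proj →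
        h.vertBracket a b x - h.vertBracket b a x = mlieBracket 𝓘(ℂ, E) a b x.proj)
    (hs : h.IsSymplectic σ) : h.IsBracketConnection cov := by
  have hg := h.isHolomorphicMetric_metric hσ
  have hff := h.isFlat_iff.1 hf
  have hss := (h.isSymplectic_iff hσ.holomorphic).1 hs
  have hv : ∀ {x : TangentBundle 𝓘(ℂ, E) M} {a b c : Π m : M, TangentSpace 𝓘(ℂ, E) m},
      HolomorphicFieldAt 𝓘(ℂ, E) a x.proj → HolomorphicFieldAt 𝓘(ℂ, E) b x.proj →
      mvfderiv 𝓘(ℂ, E).tangent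
        (fun y : TangentBundle 𝓘(ℂ, E) M => σ y.proj (a y.proj) (b y.proj)) x
        (vertLift c x) = 0 := fun ha hb =>
    mvfderiv_comp_proj_vert ((hσ.holomorphic _ _ _ ha hb).mdifferentiableAt (by simp)) _
  have hhh : ∀ (x : TangentBundle 𝓘(ℂ, E) M) (a b), h.metric σ x (h.lift x a) (h.horLift b x) = 0 :=
    fun x a b => h.metric_lift_lift σ x _ _
  have hvv : ∀ (x : TangentBundle 𝓘(ℂ, E) M) (a b), h.metric σ x (vert x a) (vertLift b x) = 0 :=
    fun x a b => h.metric_vert_vert σ x _ _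
  have hhv : ∀ (x : TangentBundle 𝓘(ℂ, E) M) (a b), h.metric σ x (h.lift x a) (vertLift b x)
      = 1 / 2 * σ x.proj a (b x.proj) := fun x a b => h.metric_lift_vert σ x _ _
  have hvh : ∀ (x : TangentBundle 𝓘(ℂ, E) M) (a b), h.metric σ x (vert x a) (h.horLift b x)
      = 1 / 2 * σ x.proj (b x.proj) a := fun x a b => h.metric_vert_lift σ x _ _
  refine ⟨fun x c a hc ha => h.metric_ext hσ (fun d hd => ?_) (fun d hd => ?_),
    fun x c a hc ha => h.metric_ext hσ (fun d hd => ?_) (fun d hd => ?_),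
    fun x c a hc ha => h.metric_ext hσ (fun d hd => ?_) (fun d hd => ?_),
    fun x c a hc ha => h.metric_ext hσ (fun d hd => ?_) (fun d hd => ?_)⟩
  all_goals
    have hhc := (hc.horLift h).differentiable
    have hha := (ha.horLift h).differentiable
    have hhd := (hd.horLift h).differentiable
    have hvc := (hc.vertLift (x := x)).differentiable
    have hva := (ha.vertLift (x := x)).differentiable
    have hvd := (hd.vertLift (x := x)).differentiable
  · rw [← hcov.koszul_eq hg hhc hha hhd, koszul, mvfderiv_metric_horLift_horLift,
      mvfderiv_metric_horLift_horLift, mvfderiv_metric_horLift_horLift, hff x c a hc ha,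
      hff x c d hc hd, hff x a d ha hd, hhh, hhh, hhh, hhh]
    ring
  · rw [← hcov.koszul_eq hg hhc hha hvd, koszul, mvfderiv_metric_horLift_horLift,
      h.mvfderiv_metric_horLift_vertLift _ hσ.holomorphic ha hd,
      h.mvfderiv_metric_horLift_vertLift _ hσ.holomorphic hc hd, hff x c a hc ha,
      h.mlieBracket_horLift_vertLift hc hd, h.mlieBracket_horLift_vertLift ha hd,
      hss x c a d hc ha hd, hss x a c d ha hc hd, ← ht x c a hc ha, hhv, hhv, hvh, hvh, map_sub,
      LinearMap.sub_apply]
    ring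
  · rw [← hcov.koszul_eq hg hhc hva hhd, koszul, mvfderiv_metric_horLift_horLift,
      h.mvfderiv_metric_vertLift_horLift _ hσ.holomorphic hd ha,
      h.mvfderiv_metric_horLift_vertLift _ hσ.holomorphic hc ha, hff x c d hc hd,
      h.mlieBracket_horLift_vertLift hc ha, h.mlieBracket_vertLift_horLift ha hd,
      hss x c d a hc hd ha, hss x d c a hd hc ha, ← ht x c d hc hd, hhv, hvh, map_neg,
      LinearMap.neg_apply, hvh, map_sub, LinearMap.sub_apply]
    ring
  · rw [← hcov.koszul_eq hg hhc hva hvd, koszul, mvfderiv_metric_vertLift_vertLift,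
      h.mvfderiv_metric_horLift_vertLift _ hσ.holomorphic hc ha,
      h.mvfderiv_metric_horLift_vertLift _ hσ.holomorphic hc hd, hv hc ha, hv hc hd,
      h.mlieBracket_horLift_vertLift hc ha, h.mlieBracket_horLift_vertLift hc hd,
      mlieBracket_vertLift_vertLift ha hd, hvv, hvv, map_zero, LinearMap.zero_apply]
    ring
  · rw [← hcov.koszul_eq hg hvc hha hhd, koszul, mvfderiv_metric_horLift_horLift,
      h.mvfderiv_metric_vertLift_horLift _ hσ.holomorphic hd hc,
      h.mvfderiv_metric_vertLift_horLift _ hσ.holomorphic ha hc, hff x a d ha hd,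
      h.mlieBracket_vertLift_horLift hc ha, h.mlieBracket_vertLift_horLift hc hd,
      hss x a d c ha hd hc, hss x d a c hd ha hc, ← ht x a d ha hd, hhv, map_neg, map_neg,
      LinearMap.neg_apply, LinearMap.neg_apply, hvh, hvh, map_sub, LinearMap.sub_apply, map_zero,
      LinearMap.zero_apply]
    ring
  · rw [← hcov.koszul_eq hg hvc hha hvd, koszul, mvfderiv_metric_vertLift_vertLift,
      h.mvfderiv_metric_horLift_vertLift _ hσ.holomorphic ha hd,
      h.mvfderiv_metric_vertLift_horLift _ hσ.holomorphic ha hc, hv ha hc, hv ha hd,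
      h.mlieBracket_vertLift_horLift hc ha, h.mlieBracket_horLift_vertLift ha hd,
      mlieBracket_vertLift_vertLift hc hd, map_neg, LinearMap.neg_apply, hvv, hvv,
      map_zero, LinearMap.zero_apply, LinearMap.zero_apply]
    ring
  · rw [← hcov.koszul_eq hg hvc hva hhd, koszul, mvfderiv_metric_vertLift_vertLift,
      h.mvfderiv_metric_vertLift_horLift _ hσ.holomorphic hd ha,
      h.mvfderiv_metric_vertLift_horLift _ hσ.holomorphic hd hc, hv hd hc, hv hd ha,
      h.mlieBracket_vertLift_horLift hc hd, h.mlieBracket_vertLift_horLift ha hd,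
      mlieBracket_vertLift_vertLift hc ha, map_neg, map_neg, LinearMap.neg_apply,
      LinearMap.neg_apply, hvv, hvv, map_zero, LinearMap.zero_apply]
    ring
  · rw [← hcov.koszul_eq hg hvc hva hvd, koszul, mvfderiv_metric_vertLift_vertLift,
      mvfderiv_metric_vertLift_vertLift, mvfderiv_metric_vertLift_vertLift,
      mlieBracket_vertLift_vertLift hc ha, mlieBracket_vertLift_vertLift hc hd,
      mlieBracket_vertLift_vertLift ha hd, map_zero, LinearMap.zero_apply, LinearMap.zero_apply,
      LinearMap.zero_apply]
    ring

theorem IsBracketConnection.isDiagonal (hc : h.IsBracketConnection cov) : h.IsDiagonal cov := by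
  intro x a ha u
  obtain ⟨c, hc', hcx⟩ := exists_holomorphicField (I := 𝓘(ℂ, E)) x.proj (h.hPart x u)
  obtain ⟨d, hd, hdx⟩ := exists_holomorphicField (I := 𝓘(ℂ, E)) x.proj (h.vPart x u)
  have hu : u = h.horLift c x + vertLift d x := by
    rw [horLift, vertLift, hcx, hdx, h.lift_add_vert]
  refine ⟨h.vertBracket c a x, ?_, ?_⟩
  · rw [hu, map_add, hc.hor_hor x c a hc' ha, hc.vert_hor x d a hd ha, add_zero]
  · rw [hu, map_add, hc.hor_vert x c a hc' ha, hc.vert_vert x d a hd ha, add_zero]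

/-- A torsion-free diagonal connection is determined by comparing the horizontal and the vertical
part of `∇_{h a} (v b) - ∇_{v b} (h a) = [h a, v b]`. -/
theorem IsDiagonal.isBracketConnection (hd : h.IsDiagonal cov)
    (hcov : IsLeviCivita 𝓘(ℂ, E).tangent (h.metric σ) cov) : h.IsBracketConnection cov := by
  have : CompleteSpace E := FiniteDimensional.complete ℂ E
  have key : ∀ (x : TangentBundle 𝓘(ℂ, E) M) (c a : Π m : M, TangentSpace 𝓘(ℂ, E) m),
      HolomorphicFieldAt 𝓘(ℂ, E) c x.proj → HolomorphicFieldAt 𝓘(ℂ, E) a x.proj →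
      cov (h.horLift a) x (h.horLift c x) = h.lift x (h.vertBracket c a x) ∧
      cov (vertLift a) x (h.horLift c x) = vert x (h.vertBracket c a x) ∧
      cov (h.horLift c) x (vertLift a x) = 0 ∧ cov (vertLift c) x (vertLift a x) = 0 := by
    intro x c a hc ha
    obtain ⟨p, hp₁, hp₂⟩ := hd x a ha (h.horLift c x)
    obtain ⟨q, hq₁, hq₂⟩ := hd x c hc (vertLift a x)
    have ht := cov.torsion_eq_zero_iff.1 hcov.torsion_free (hc.horLift h).differentiable
      (ha.vertLift (x := x)).differentiable
    rw [h.mlieBracket_horLift_vertLift hc ha, hp₂, hq₁] at ht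
    have hq : q = 0 := by
      simpa [projDeriv_vert, h.proj_lift] using congrArg (projDeriv x) ht
    subst hq
    rw [map_zero, sub_zero] at ht
    rw [← vert_injective x ht]
    exact ⟨hp₁, hp₂, hq₁.trans (map_zero _), hq₂.trans (map_zero _)⟩
  exact ⟨fun x c a hc ha => (key x c a hc ha).1, fun x c a hc ha => (key x c a hc ha).2.1,
    fun x c a hc ha => (key x a c ha hc).2.2.1, fun x c a hc ha => (key x a c ha hc).2.2.2⟩

section
variable (hc : h.IsBracketConnection cov)
  (hcov : IsLeviCivita 𝓘(ℂ, E).tangent (h.metric σ) cov)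
include hc hcov

theorem IsBracketConnection.mlieBracket_horLift_horLift
    (ha : HolomorphicFieldAt 𝓘(ℂ, E) a x.proj) (hb : HolomorphicFieldAt 𝓘(ℂ, E) b x.proj) :
    mlieBracket 𝓘(ℂ, E).tangent (h.horLift a) (h.horLift b) x
      = h.lift x (h.vertBracket a b x - h.vertBracket b a x) := by
  have : CompleteSpace E := FiniteDimensional.complete ℂ E
  have ht := cov.torsion_eq_zero_iff.1 hcov.torsion_free (ha.horLift h).differentiable
    (hb.horLift h).differentiable
  rw [← ht, hc.hor_hor x a b ha hb, hc.hor_hor x b a hb ha, map_sub]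

theorem IsBracketConnection.vertBracket_sub
    (ha : HolomorphicFieldAt 𝓘(ℂ, E) a x.proj) (hb : HolomorphicFieldAt 𝓘(ℂ, E) b x.proj) :
    h.vertBracket a b x - h.vertBracket b a x = mlieBracket 𝓘(ℂ, E) a b x.proj := by
  rw [← h.projDeriv_mlieBracket_horLift_horLift ha hb,
    hc.mlieBracket_horLift_horLift hcov ha hb, h.proj_lift]

theorem IsBracketConnection.isFlat : h.IsFlat :=
  h.isFlat_iff.2 fun x a b ha hb => by
    rw [hc.mlieBracket_horLift_horLift hcov ha hb, hc.vertBracket_sub hcov ha hb]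

theorem IsBracketConnection.isSymplectic (hσ : IsHolomorphicBilin 𝓘(ℂ, E) σ) :
    h.IsSymplectic σ :=
  (h.isSymplectic_iff hσ).2 fun x c a b hc' ha hb => by
    have h₁ := hcov.metric x _ _ (ha.horLift h).differentiable hb.vertLift.differentiable
      (h.horLift c x)
    rw [h.mvfderiv_metric_horLift_vertLift _ hσ ha hb, hc.hor_hor x c a hc' ha,
      hc.hor_vert x c b hc' hb, vertLift, metric_lift_vert, horLift, horLift, metric_lift_vert,
      ← mul_add] at h₁
    exact mul_left_cancel₀ (by norm_num) h₁

end

theorem isParallel_iff (hσ : IsHolomorphicSymplectic 𝓘(ℂ, E) σ)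
    (hcov : IsLeviCivita 𝓘(ℂ, E).tangent (h.metric σ) cov) :
    (IsParallel 𝓘(ℂ, E).tangent cov h.opI ∧ IsParallel 𝓘(ℂ, E).tangent cov h.opJ ∧
      IsParallel 𝓘(ℂ, E).tangent cov h.opK) ↔
    ∀ ε : ℂ, ε ≠ 0 → (h.pencil ε).IsFlat ∧ (h.pencil ε).IsSymplectic σ := by
  constructor
  · rintro ⟨hI, hJ, -⟩ ε hε
    have hc := (isDiagonal_of_isParallel hI hJ).isBracketConnection hcov
    exact ⟨h.forall_isFlat_pencil_iff.2 ⟨hc.isFlat hcov, fun x a b => hc.vertBracket_sub hcov⟩ ε hε,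
      (h.isSymplectic_pencil_iff hσ.holomorphic ε).2 (hc.isSymplectic hcov hσ.holomorphic)⟩
  · intro hp
    obtain ⟨hf, ht⟩ := h.forall_isFlat_pencil_iff.1 fun ε hε => (hp ε hε).1
    have hs := (h.isSymplectic_pencil_iff hσ.holomorphic 1).1 (hp 1 one_ne_zero).2
    have hd := (hcov.isBracketConnection hσ hf ht hs).isDiagonal
    exact ⟨hd.isParallel_opI, hd.isParallel_opJ, hd.isParallel_opK⟩

end NonlinearConnection
end LeviCivita

end PreJoyce

end

theorem mainTheorem1 {E : Type*} [NormedAddCommGroup E] [NormedSpace ℂ E] [FiniteDimensional ℂ E]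
    {M : Type*} [TopologicalSpace M] [ChartedSpace E M] [IsManifold 𝓘(ℂ, E) ω M]
    (σ : Π m : M, LinearMap.BilinForm ℂ (TangentSpace 𝓘(ℂ, E) m))
    (hσ : PreJoyce.IsHolomorphicSymplectic 𝓘(ℂ, E) σ)
    (h : PreJoyce.NonlinearConnection E M) :
    PreJoyce.IsHolomorphicMetric 𝓘(ℂ, E).tangent (h.metric σ) ∧
    (∃ cov : CovariantDerivative 𝓘(ℂ, E).tangent (E × E)
        (TangentSpace 𝓘(ℂ, E).tangent : TangentBundle 𝓘(ℂ, E) M → Type _),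
      PreJoyce.IsLeviCivita 𝓘(ℂ, E).tangent (h.metric σ) cov) ∧
    (∀ cov : CovariantDerivative 𝓘(ℂ, E).tangent (E × E)
        (TangentSpace 𝓘(ℂ, E).tangent : TangentBundle 𝓘(ℂ, E) M → Type _),
      PreJoyce.IsLeviCivita 𝓘(ℂ, E).tangent (h.metric σ) cov →
      ((PreJoyce.IsParallel 𝓘(ℂ, E).tangent cov h.opI ∧
          PreJoyce.IsParallel 𝓘(ℂ, E).tangent cov h.opJ ∧
          PreJoyce.IsParallel 𝓘(ℂ, E).tangent cov h.opK) ↔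
        ∀ ε : ℂ, ε ≠ 0 → (h.pencil ε).IsFlat ∧ (h.pencil ε).IsSymplectic σ)) ∧
    (h.IsPreJoyce σ →
      PreJoyce.IsComplexHyperkahler 𝓘(ℂ, E).tangent (h.metric σ) h.opI h.opJ h.opK) := by
  have hg := h.isHolomorphicMetric_metric hσ
  have hcov := hg.exists_isLeviCivita
  refine ⟨hg, hcov, fun cov hc => PreJoyce.NonlinearConnection.isParallel_iff hσ hc, fun hp => ?_⟩
  obtain ⟨cov, hc⟩ := hcov
  exact
    { metric := hg
      holomorphic_A := h.isHolomorphicEnd_opI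
      holomorphic_B := h.isHolomorphicEnd_opJ
      holomorphic_C := h.isHolomorphicEnd_opK
      sq_A := h.opI_mul_opI
      sq_B := h.opJ_mul_opJ
      sq_C := h.opK_mul_opK
      mul_ABC := h.opI_mul_opJ_mul_opK
      isometry_A := fun x => h.metric_opI x
      isometry_B := fun x => h.metric_opJ x hσ.alternating
      isometry_C := fun x => h.metric_opK x hσ.alternating
      parallel := ⟨cov, hc, (PreJoyce.NonlinearConnection.isParallel_iff hσ hc).2 hp.2⟩ }
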